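/- For a finitely generated group $G$ let $a_n^{\leq}(G)$ and $a_n^{\lhd}(G)$ be the (finite) numbers of subgroups, respectively normal subgroups, of index $n$ in $G$, and for $*\in\{\leq,\lhd\}$ put $$\alpha_G^*:=\inf\Big\{\alpha\in\mathbb{R}\ \Big|\ \exists\, C>0\ \forall n\geq 1:\ \sum_{i=1}^n a_i^*(G)\leq C n^\alpha\Big\}\qquad(\inf\emptyset=\infty).$$ A $\mathfrak{T}$-group is a finitely generated torsion-free nilpotent group; its Hirsch length is the number of infinite factors in a subnormal series with cyclic factors. Theorem. Let $N$ be a non-abelian $\mathfrak{T}$-group of Hirsch length $h$ and nilpotency class $c$. Then $\alpha_N^{\leq}\leq h-\frac12$ if $c=2$, and $\alpha_N^{\leq}\leq h-\frac{1}{c-1}$ if $c>2$. Also $\alpha_N^{\lhd}\leq h-1$. Consequently, for every integer $h\geq 0$, up to isomorphism the only $\mathfrak{T}$-group $N$ of Hirsch length $h$ with $\alpha_N^{\leq}=h$ is the free abelian group $\mathbb{Z}^h$; that is, $\mathbb{Z}^h$ is a $\mathfrak{T}$-group of Hirsch length $h$ with $\alpha_{\mathbb{Z}^h}^{\leq}=h$,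 and every $\mathfrak{T}$-group $N$ of Hirsch length $h$ with $\alpha_N^{\leq}=h$ is isomorphic to $\mathbb{Z}^h$. -/

import Mathlib

universe u

/-- A `𝔗`-group: a finitely generated torsion-free nilpotent group. -/
structure IsTGroup (G : Type*) [Group G] : Prop where
  fg : Group.FG G
  nilpotent : Group.IsNilpotent G
  torsionFree : ∀ g : G, g ≠ 1 → ¬ IsOfFinOrder g

/-- `G` (is polycyclic and) has Hirsch length `h`: there is a subnormal series
`1 = H 0 ⊴ H 1 ⊴ ⋯ ⊴ H n = G` with cyclic factors, exactly `h` of which are infinite. -/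
def HasHirschLength (G : Type*) [Group G] (h : ℕ) : Prop :=
  ∃ (n : ℕ) (H : ℕ → Subgroup G),
    H 0 = ⊥ ∧ H n = ⊤ ∧
    (∀ i < n, H i ≤ H (i + 1)) ∧
    (∀ i < n, ∃ _ : ((H i).subgroupOf (H (i + 1))).Normal,
      IsCyclic (↥(H (i + 1)) ⧸ (H i).subgroupOf (H (i + 1)))) ∧
    {i : ℕ | i < n ∧ Infinite (↥(H (i + 1)) ⧸ (H i).subgroupOf (H (i + 1)))}.ncard = h

/-- The number of subgroups of index `n` (finite for `1 ≤ n` when `G` is finitely generated). -/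
noncomputable def numSubgroups (G : Type*) [Group G] (n : ℕ) : ℕ :=
  {H : Subgroup G | H.index = n}.ncard

/-- The number of normal subgroups of index `n`
(finite for `1 ≤ n` when `G` is finitely generated). -/
noncomputable def numNormalSubgroups (G : Type*) [Group G] (n : ℕ) : ℕ :=
  {H : Subgroup G | H.Normal ∧ H.index = n}.ncard

/-- The polynomial growth degree of a counting sequence `a 1, a 2, …`: the infimum of the real
`α` such that `a 1 + ⋯ + a n ≤ C * n ^ α` for some `C > 0` and all `n ≥ 1`.
It is `⊤` if there is no such `α`. -/
noncomputable def growthDegree (a : ℕ → ℕ) : EReal :=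
  sInf {x : EReal | ∃ α : ℝ, x = (α : EReal) ∧
    ∃ C : ℝ, 0 < C ∧ ∀ n : ℕ, 1 ≤ n →
      ((∑ i ∈ Finset.Icc 1 n, a i : ℕ) : ℝ) ≤ C * (n : ℝ) ^ α}

/-- The degree of polynomial subgroup growth of `G`. -/
noncomputable def alphaSub (G : Type*) [Group G] : EReal :=
  growthDegree (numSubgroups G)

/-- The degree of polynomial normal subgroup growth of `G`. -/
noncomputable def alphaNormal (G : Type*) [Group G] : EReal :=
  growthDegree (numNormalSubgroups G)

/-!
Subgroups of an extension are counted one layer at a time. Let `π : G → Q` be surjective. A subgroup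
`H` of `G` is determined by its image `A` in `Q`, its trace `B` on `ker π`, and the cosets modulo
`B` of lifts of generators of `A`; so if `A` needs `d` generators, at most `[ker π : B] ^ d`
subgroups share `(A, B)` (`fibre_finite_and_ncard_le`). A poly-(infinite cyclic) group of length
`n`, such as a torsion-free finitely generated nilpotent group of Hirsch length `n`, therefore has
at most `X ^ n` subgroups of index at most `X` (`IsPolyInt.finite_and_ncard_le`).

For a non-abelian `N` choose `y` central modulo the centre `K` and `x` with `w = ⁅x, y⁆ ≠ 1`, and
let `Z ≅ ℤ` be the isolator of `⟨w⟩` in `K`. The layers `Z`, `K / Z` and `N / K` have lengths `1`,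
`t` and `q`, with `q + t + 1 = h`. If `H` has image `A` in `N / K` and trace of index `m` on `Z`,
then `A` meets the image of `⟨x, y⟩` in a lattice of determinant at most `[N / K : A]`. Commutators
turn this determinant into a power of `w` in `H`, so `m ≤ k * [N / K : A]` with `k = [Z : ⟨w⟩]`
(`commutator_pow_mem`). As `m * [N / K : A] ≤ X`, only `m ≤ √(k X)` occurs, and the count drops from
`X ^ h` to `√(k X) * X ^ t * X ^ q` (`finite_and_ncard_subgroupsLE_le`). This gives the bound
`h - 1 / 2`, which does not depend on the class and is at least as strong as `h - 1 / (c - 1)` for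
`c > 2`.

If `H` is normal with trace `B` on `K`, then `⁅v, y⁆ ∈ B` for all `v ∈ H`, which confines `A` to a
subgroup of `N / K` of index at least `m / k`. Summing over the possible `B` leaves
`k * X ^ q * X ^ t * (1 + 1 / 2 + ⋯ + 1 / X)` (`finite_and_ncard_normal_le`), hence the bound `h - 1`.

The Hirsch length is independent of the series (`HasHirschLength.unique`), because along any chain
of subgroups the number of infinite factors seen by a fixed series strictly increases at each step
of infinite index. Finally `ℤ ^ (m + 1)` has at least `n ^ m` subgroups of index `n`, the kernels of
`v ↦ v₀ + c₁ v₁ + ⋯ + cₘ vₘ` modulo `n`, so that its growth degree is exactly its rank.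
-/

open Subgroup
open scoped commutatorElement

/-! ### Counting subgroups of an extension -/

/-- The subgroups of finite index at most `X`. -/
def subgroupsLE (G : Type*) [Group G] (X : ℕ) : Set (Subgroup G) :=
  {H | H.index ≠ 0 ∧ H.index ≤ X}

/-- The subgroup `A` can be generated by `d` elements, not necessarily distinct. -/
def IsGeneratedBy {G : Type*} [Group G] (A : Subgroup G) (d : ℕ) : Prop :=
  ∃ s : Fin d → G, closure (Set.range s) = A

section Fibre

variable {G Q : Type*} [Group G] [Group Q]

/-- The counterpart of `Subgroup.relIndex_sup_right`, with the index of the subgroup that need not be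
normal. -/
theorem relIndex_sup_of_normal (H K : Subgroup G) [K.Normal] :
    H.relIndex (H ⊔ K) = H.relIndex K := by
  refine (Nat.card_congr (Equiv.ofBijective
    (quotientSubgroupOfEmbeddingOfLE H (le_sup_right : K ≤ H ⊔ K))
    ⟨(quotientSubgroupOfEmbeddingOfLE H _).injective, fun q ↦ ?_⟩)).symm
  obtain ⟨⟨x, hx⟩, rfl⟩ := QuotientGroup.mk_surjective q
  obtain ⟨k, hk, h, hh, rfl⟩ : ∃ k ∈ K, ∃ h ∈ H, k * h = x := by
    rw [sup_comm] at hx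
    exact mem_sup_of_normal_left.1 hx
  refine ⟨QuotientGroup.mk ⟨k, hk⟩, ?_⟩
  rw [quotientSubgroupOfEmbeddingOfLE_apply_mk, QuotientGroup.eq, mem_subgroupOf]
  simpa using hh

theorem index_eq_map_mul_subgroupOf_ker {π : G →* Q} (hπ : Function.Surjective π)
    (H : Subgroup G) : H.index = (H.map π).index * (H.subgroupOf π.ker).index := by
  rw [index_map, π.range_eq_top.2 hπ, index_top, mul_one, ← Subgroup.relIndex, mul_comm,
    ← relIndex_sup_of_normal, relIndex_mul_index le_sup_left]

/-- The uniqueness half of `fibre_finite_and_ncard_le`: subgroups with the same trace on the kernel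
coincide once they share lifts of generators of the image. -/
theorem le_of_lifts_mem {π : G →* Q} {d : ℕ} {s : Fin d → Q} {H H' : Subgroup G}
    (hs : H.map π = closure (Set.range s)) (hker : H.subgroupOf π.ker = H'.subgroupOf π.ker)
    {t : Fin d → G} (ht : ∀ i, π (t i) = s i) (htH : ∀ i, t i ∈ H) (htH' : ∀ i, t i ∈ H') :
    H ≤ H' := by
  intro v hv
  have hts : (closure (Set.range t)).map π = H.map π := by
    rw [MonoidHom.map_closure, hs, ← Set.range_comp]
    exact congrArg _ (congrArg _ (funext ht))
  obtain ⟨u, hu, huv⟩ := hts.ge (mem_map_of_mem π hv)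
  have huH : u ∈ H := (closure_le H).2 (Set.range_subset_iff.2 htH) hu
  have huH' : u ∈ H' := (closure_le H').2 (Set.range_subset_iff.2 htH') hu
  have hk : u⁻¹ * v ∈ π.ker := by simp [MonoidHom.mem_ker, huv]
  have h1 : (⟨u⁻¹ * v, hk⟩ : π.ker) ∈ H'.subgroupOf π.ker := by
    rw [← hker]; exact mem_subgroupOf.2 (H.mul_mem (H.inv_mem huH) hv)
  simpa using H'.mul_mem huH' (mem_subgroupOf.1 h1)

/-- A subgroup `H` is determined by its image `A`, its intersection `B` with the kernel and the
cosets modulo `B` of lifts to `H` of the generators of `A`. -/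
theorem fibre_finite_and_ncard_le (π : G →* Q) {d : ℕ} {A : Subgroup Q} (hA : IsGeneratedBy A d)
    {B : Subgroup π.ker} (hB : B.index ≠ 0) :
    {H : Subgroup G | H.map π = A ∧ H.subgroupOf π.ker = B}.Finite ∧
      {H : Subgroup G | H.map π = A ∧ H.subgroupOf π.ker = B}.ncard ≤ B.index ^ d := by
  set S := {H : Subgroup G | H.map π = A ∧ H.subgroupOf π.ker = B} with hS
  obtain ⟨s, hs⟩ := hA
  have : Finite (π.ker ⧸ B) := index_ne_zero_iff_finite.1 hB
  rcases S.eq_empty_or_nonempty with h0 | ⟨H₀, hH₀⟩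
  · simp [h0]
  have lift : ∀ H ∈ S, ∀ i, ∃ t ∈ H, π t = s i := fun H hH i ↦ by
    have : s i ∈ H.map π := by
      rw [hH.1, ← hs]; exact subset_closure ⟨i, rfl⟩
    exact this
  choose! t htH hts using lift
  have hk : ∀ H : Subgroup G, H ∈ S → ∀ i, (t H₀ i)⁻¹ * t H i ∈ π.ker := fun H hH i ↦ by
    simp [MonoidHom.mem_ker, hts _ hH, hts _ hH₀]
  classical
  -- outside `S` the value is irrelevant
  let F : Subgroup G → (Fin d → π.ker ⧸ B) := fun H i ↦
    if h : H ∈ S then QuotientGroup.mk ⟨(t H₀ i)⁻¹ * t H i, hk H h i⟩ else QuotientGroup.mk 1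
  have hF : Set.InjOn F S := by
    have key : ∀ H ∈ S, ∀ H' ∈ S, F H = F H' → H' ≤ H := by
      intro H hH H' hH' hFF
      refine le_of_lifts_mem (hH'.1.trans hs.symm) (hH'.2.trans hH.2.symm) (hts H' hH')
        (htH H' hH') fun i ↦ ?_
      have h1 := congrFun hFF i
      simp only [F, dif_pos hH, dif_pos hH'] at h1
      rw [QuotientGroup.eq, ← hH.2, mem_subgroupOf] at h1
      simp only [coe_mul, coe_inv, mul_inv_rev, inv_inv, mul_assoc, mul_inv_cancel_left] at h1
      simpa using H.mul_mem (htH H hH i) h1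
    exact fun H hH H' hH' h ↦ le_antisymm (key H' hH' H hH h.symm) (key H hH H' hH' h)
  refine ⟨Set.Finite.of_finite_image (Set.toFinite (F '' S)) hF, ?_⟩
  calc S.ncard = (F '' S).ncard := hF.ncard_image.symm
    _ ≤ Nat.card (Fin d → π.ker ⧸ B) := by
      rw [← Set.ncard_univ]; exact Set.ncard_le_ncard (Set.subset_univ _)
    _ = B.index ^ d := by rw [Nat.card_fun]; simp [Subgroup.index]

/-- Let the subgroups in `S` have traces `B` on the kernel in a given finite set `𝓑` and images in
`L B`. If the subgroups of `L B` grow with degree `d`, the factor `[ker π : B] ^ d` from the fibres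
cancels against the index of `B`, and each `B` accounts for at most `(X / [Q : L B]) ^ d` elements
of `S`. -/
theorem finite_and_ncard_le_sum_of_isGeneratedBy {π : G →* Q} (hπ : Function.Surjective π) {d X : ℕ}
    (hgen : ∀ A : Subgroup Q, IsGeneratedBy A d)
    {S : Set (Subgroup G)} (hS : S ⊆ subgroupsLE G X) (𝓑 : Finset (Subgroup π.ker))
    (hS𝓑 : ∀ H ∈ S, H.subgroupOf π.ker ∈ 𝓑) (L : Subgroup π.ker → Subgroup Q)
    (hL : ∀ H ∈ S, H.map π ≤ L (H.subgroupOf π.ker))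
    (h𝓑 : ∀ B ∈ 𝓑, B.index ≠ 0)
    (hcount : ∀ B ∈ 𝓑, ∀ Y, {A ∈ subgroupsLE Q Y | A ≤ L B}.Finite ∧
      {A ∈ subgroupsLE Q Y | A ≤ L B}.ncard ≤ (Y / (L B).index) ^ d) :
    S.Finite ∧ S.ncard ≤ ∑ B ∈ 𝓑, (X / (L B).index) ^ d := by
  classical
  have hfin := fun B hB Y ↦ (hcount B hB Y).1
  let 𝓐 : Subgroup π.ker → Finset (Subgroup Q) := fun B ↦
    if hB : B ∈ 𝓑 then (hfin B hB (X / B.index)).toFinset else ∅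
  let F : Subgroup π.ker → Subgroup Q → Finset (Subgroup G) := fun B A ↦
    if hB : B ∈ 𝓑 then (fibre_finite_and_ncard_le π (hgen A) (h𝓑 B hB)).1.toFinset else ∅
  have hcov : S ⊆ ↑(𝓑.biUnion fun B ↦ (𝓐 B).biUnion fun A ↦ F B A) := by
    intro H hH
    have hB := hS𝓑 H hH
    have hidx := index_eq_map_mul_subgroupOf_ker hπ H
    have h1 := hS hH
    have hB0 := Nat.pos_of_ne_zero (h𝓑 _ hB)
    simp only [Finset.coe_biUnion, Set.mem_iUnion, Finset.mem_coe]
    refine ⟨_, hB, H.map π, ?_, ?_⟩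
    · simp only [𝓐, dif_pos hB, Set.Finite.mem_toFinset]
      refine ⟨⟨fun h0 ↦ h1.1 (by rw [hidx, h0, zero_mul]), ?_⟩, hL H hH⟩
      rw [Nat.le_div_iff_mul_le hB0, ← hidx]
      exact h1.2
    · simp only [F, dif_pos hB, Set.Finite.mem_toFinset]
      exact ⟨rfl, rfl⟩
  refine ⟨(Finset.finite_toSet _).subset hcov, ?_⟩
  calc S.ncard ≤ (𝓑.biUnion fun B ↦ (𝓐 B).biUnion fun A ↦ F B A).card := by
        rw [← Set.ncard_coe_finset]; exact Set.ncard_le_ncard hcov (Finset.finite_toSet _)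
    _ ≤ ∑ B ∈ 𝓑, ∑ A ∈ 𝓐 B, (F B A).card :=
        Finset.card_biUnion_le.trans (Finset.sum_le_sum fun B _ ↦ Finset.card_biUnion_le)
    _ ≤ ∑ B ∈ 𝓑, (X / (L B).index) ^ d := Finset.sum_le_sum fun B hB ↦ by
        have h1 : ∀ A ∈ 𝓐 B, (F B A).card ≤ B.index ^ d := fun A _ ↦ by
          simp only [F, dif_pos hB]
          rw [← Set.ncard_eq_toFinset_card _ _]
          exact (fibre_finite_and_ncard_le π (hgen A) (h𝓑 B hB)).2
        have h2 : (𝓐 B).card ≤ (X / B.index / (L B).index) ^ d := by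
          simp only [𝓐, dif_pos hB]
          rw [← Set.ncard_eq_toFinset_card _ _]
          exact (hcount B hB _).2
        calc ∑ A ∈ 𝓐 B, (F B A).card ≤ (𝓐 B).card * B.index ^ d := by
              simpa using Finset.sum_le_card_nsmul _ _ _ h1
          _ ≤ (X / B.index / (L B).index) ^ d * B.index ^ d := Nat.mul_le_mul_right _ h2
          _ = (X / (L B).index / B.index * B.index) ^ d := by
              rw [mul_pow, Nat.div_div_eq_div_mul, mul_comm B.index, Nat.div_div_eq_div_mul]
          _ ≤ _ := Nat.pow_le_pow_left (Nat.div_mul_le_self _ _) d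

end Fibre

/-! ### Poly-(infinite cyclic) groups -/

/-- `G` is poly-(infinite cyclic) of length `n`: it is trivial if `n = 0`, and otherwise maps onto
`ℤ` with kernel poly-(infinite cyclic) of length `n - 1`. -/
def IsPolyInt : ∀ (_ : ℕ) (G : Type*) [Group G], Prop
  | 0, G, _ => Subsingleton G
  | n + 1, G, _ => ∃ f : G →* Multiplicative ℤ, Function.Surjective f ∧ IsPolyInt n f.ker

/-- Subgroups of `ℤ` are determined by their index. -/
theorem multiplicative_int_subgroup_eq_of_index_eq {A B : Subgroup (Multiplicative ℤ)}
    (h : A.index = B.index) : A = B := by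
  have key : ∀ A : Subgroup (Multiplicative ℤ),
      toAddSubgroup' A = AddSubgroup.zmultiples ((A.index : ℕ) : ℤ) := by
    intro A
    obtain ⟨a, ha⟩ := Int.subgroup_cyclic (toAddSubgroup' A)
    have h1 : A.index = (toAddSubgroup' A).index := rfl
    rw [← AddSubgroup.zmultiples_eq_closure] at ha
    rw [h1, ha, Int.index_zmultiples, Int.natCast_natAbs]
    rcases abs_choice a with h | h <;> simp [h]
  exact toAddSubgroup'.injective (by rw [key, key, h])


theorem isGeneratedBy_one_of_isCyclic {C : Type*} [Group C] [IsCyclic C] (A : Subgroup C) :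
    IsGeneratedBy A 1 := by
  obtain ⟨a, ha⟩ := (Subgroup.isCyclic_iff_exists_zpowers_eq_top A).1 inferInstance
  exact ⟨fun _ ↦ a, by rw [← ha, Set.range_const, zpowers_eq_closure]⟩

/-- A subgroup of an infinite cyclic group containing `w ≠ 1` has index at most `|w|`. -/
theorem multiplicative_int_index_le {C : Subgroup (Multiplicative ℤ)} {w : Multiplicative ℤ}
    (hw : w ≠ 1) (hwC : w ∈ C) : C.index ≠ 0 ∧ C.index ≤ w.toAdd.natAbs := by
  have h1 : C.index = (toAddSubgroup' C).index := rfl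
  have h2 : AddSubgroup.zmultiples w.toAdd ≤ toAddSubgroup' C := by
    rw [AddSubgroup.zmultiples_le]; exact hwC
  have h3 := AddSubgroup.index_dvd_of_le h2
  rw [Int.index_zmultiples] at h3
  have h4 : w.toAdd.natAbs ≠ 0 := by simpa using hw
  rw [h1]
  exact ⟨fun h ↦ h4 (by rwa [h, zero_dvd_iff] at h3), Nat.le_of_dvd (Nat.pos_of_ne_zero h4) h3⟩

theorem multiplicative_int_finite_and_ncard_le (X : ℕ) :
    (subgroupsLE (Multiplicative ℤ) X).Finite ∧
      (subgroupsLE (Multiplicative ℤ) X).ncard ≤ X := by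
  have hinj : Set.InjOn (Subgroup.index : Subgroup (Multiplicative ℤ) → ℕ)
      (subgroupsLE (Multiplicative ℤ) X) :=
    fun _ _ _ _ h ↦ multiplicative_int_subgroup_eq_of_index_eq h
  have hmaps : Set.MapsTo (Subgroup.index : Subgroup (Multiplicative ℤ) → ℕ)
      (subgroupsLE (Multiplicative ℤ) X) (Finset.Icc 1 X : Finset ℕ) := fun A hA ↦ by
    simpa using ⟨Nat.pos_of_ne_zero hA.1, hA.2⟩
  refine ⟨Set.Finite.of_injOn hmaps hinj (Finset.finite_toSet _), ?_⟩
  simpa [Set.ncard_coe_finset] using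
    Set.ncard_le_ncard_of_injOn _ hmaps hinj (Finset.finite_toSet _)

theorem nonempty_mulEquiv_multiplicative_int (G : Type*) [Group G] [IsCyclic G] [Infinite G] :
    Nonempty (G ≃* Multiplicative ℤ) :=
  ⟨mulEquivOfCyclicCardEq (by simp)⟩

theorem IsPolyInt.of_mulEquiv {n : ℕ} {G G' : Type*} [Group G] [Group G'] (e : G ≃* G')
    (h : IsPolyInt n G) : IsPolyInt n G' := by
  induction n generalizing G G' with
  | zero => exact e.symm.toEquiv.subsingleton_congr.2 h
  | succ n ih =>
    obtain ⟨f, hf, hk⟩ := h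
    refine ⟨f.comp e.symm.toMonoidHom, hf.comp e.symm.surjective, ?_⟩
    have h1 : (f.comp e.symm.toMonoidHom).ker = f.ker.map e.toMonoidHom := by
      rw [← MonoidHom.comap_ker]
      exact (map_equiv_eq_comap_symm' e f.ker).symm
    rw [h1]
    exact ih (e.subgroupMap f.ker) hk

theorem isPolyInt_map_subtype {n : ℕ} {G : Type*} [Group G] {K : Subgroup G} {A : Subgroup K} :
    IsPolyInt n (A.map K.subtype) ↔ IsPolyInt n A :=
  ⟨.of_mulEquiv (A.equivMapOfInjective _ K.subtype_injective).symm,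
    .of_mulEquiv (A.equivMapOfInjective _ K.subtype_injective)⟩

theorem isPolyInt_subgroupOf_comm {n : ℕ} {G : Type*} [Group G] {A B : Subgroup G} :
    IsPolyInt n (A.subgroupOf B) ↔ IsPolyInt n (B.subgroupOf A) := by
  rw [← isPolyInt_map_subtype, ← isPolyInt_map_subtype, subgroupOf_map_subtype,
    subgroupOf_map_subtype, inf_comm]

/-- Being poly-(infinite cyclic) is closed under extensions, and the lengths add up. -/
theorem IsPolyInt.of_extension {a b : ℕ} {G : Type*} {Q : Type*} [Group G] [Group Q] {π : G →* Q}
    (hπ : Function.Surjective π) (hk : IsPolyInt a π.ker) (hQ : IsPolyInt b Q) :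
    IsPolyInt (a + b) G := by
  induction b generalizing G Q with
  | zero =>
    have : Subsingleton Q := hQ
    have h1 : π.ker = ⊤ := by
      ext x; simp [MonoidHom.mem_ker, Subsingleton.elim (π x) 1]
    rw [h1] at hk
    exact hk.of_mulEquiv topEquiv
  | succ b ih =>
    obtain ⟨f, hf, hfk⟩ := hQ
    refine ⟨f.comp π, hf.comp hπ, ?_⟩
    let ρ : (f.comp π).ker →* f.ker :=
      (π.comp (f.comp π).ker.subtype).codRestrict f.ker fun x ↦ x.2
    refine ih (π := ρ) ?_ ?_ hfk
    · rintro ⟨y, hy⟩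
      obtain ⟨x, rfl⟩ := hπ y
      exact ⟨⟨x, hy⟩, rfl⟩
    · have h1 : ρ.ker = π.ker.subgroupOf (f.comp π).ker := by
        ext x
        simp only [ρ, MonoidHom.mem_ker, mem_subgroupOf, Subtype.ext_iff]
        rfl
      rw [h1]
      refine hk.of_mulEquiv (subgroupOfEquivOfLe ?_).symm
      intro x hx
      simp [MonoidHom.mem_ker, (MonoidHom.mem_ker).1 hx]

/-- Subgroups of finite index of a poly-(infinite cyclic) group have the same length. -/
theorem IsPolyInt.of_index_ne_zero {n : ℕ} {G : Type*} [Group G] (h : IsPolyInt n G)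
    {K : Subgroup G} (hK : K.index ≠ 0) : IsPolyInt n K := by
  induction n generalizing G with
  | zero =>
    have : Subsingleton G := h
    exact inferInstanceAs (Subsingleton K)
  | succ n ih =>
    obtain ⟨f, hf, hk⟩ := h
    have hne : Infinite (K.map f) := by
      have h1 : (K.map f).index ≠ 0 := fun h0 ↦
        hK (zero_dvd_iff.1 (h0 ▸ index_map_dvd K hf))
      by_contra hfin
      rw [not_infinite_iff_finite] at hfin
      have h2 := card_mul_index (K.map f)
      rw [Nat.card_eq_zero_of_infinite (α := Multiplicative ℤ), mul_eq_zero] at h2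
      exact h2.elim Nat.card_pos.ne' h1
    obtain ⟨e⟩ := nonempty_mulEquiv_multiplicative_int (K.map f)
    let g : K →* Multiplicative ℤ := e.toMonoidHom.comp (f.subgroupMap K)
    refine ⟨g, e.surjective.comp (f.subgroupMap_surjective K), ?_⟩
    have h1 : g.ker = f.ker.subgroupOf K := by
      ext x
      simp only [g, MonoidHom.mem_ker, mem_subgroupOf, MonoidHom.comp_apply]
      simp [Subtype.ext_iff]
    rw [h1, isPolyInt_subgroupOf_comm]
    exact ih hk fun h0 ↦ hK (index_eq_zero_of_relIndex_eq_zero h0)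

theorem IsGeneratedBy.of_extension {n : ℕ} {G Q : Type*} [Group G] [Group Q] {f : G →* Q}
    {A : Subgroup G} (hk : IsGeneratedBy (A.subgroupOf f.ker) n) (hA : IsGeneratedBy (A.map f) 1) :
    IsGeneratedBy A (n + 1) := by
  obtain ⟨s, hs⟩ := hk
  obtain ⟨t, ht⟩ := hA
  obtain ⟨a, haA, ha⟩ : t 0 ∈ A.map f := by rw [← ht]; exact subset_closure ⟨0, rfl⟩
  have hsA : ∀ i, (s i : G) ∈ A := fun i ↦ by
    have : s i ∈ A.subgroupOf f.ker := by rw [← hs]; exact subset_closure ⟨i, rfl⟩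
    exact this
  have hle : closure (Set.range (Fin.cons a fun i ↦ (s i : G) : Fin (n + 1) → G)) ≤ A := by
    rw [closure_le]
    rintro _ ⟨i, rfl⟩
    exact Fin.cases haA (fun j ↦ hsA j) i
  refine ⟨Fin.cons a fun i ↦ (s i : G), le_antisymm hle ?_⟩
  refine le_of_lifts_mem (π := f) (s := t) (t := fun _ ↦ a) ht.symm ?_ ?_ (fun _ ↦ haA) ?_
  · refine le_antisymm ?_ (comap_mono hle)
    rw [← hs, closure_le]
    rintro _ ⟨i, rfl⟩
    exact subset_closure ⟨i.succ, rfl⟩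
  · intro i; rw [ha, Subsingleton.elim i 0]
  · intro i; exact subset_closure ⟨0, rfl⟩

theorem IsPolyInt.isGeneratedBy {n : ℕ} {G : Type*} [Group G] (h : IsPolyInt n G)
    (A : Subgroup G) : IsGeneratedBy A n := by
  induction n generalizing G with
  | zero =>
    have : Subsingleton G := h
    exact ⟨fun _ ↦ 1, Subsingleton.elim _ _⟩
  | succ n ih =>
    obtain ⟨f, -, hk⟩ := h
    exact (ih hk _).of_extension (isGeneratedBy_one_of_isCyclic _)

/-- A poly-(infinite cyclic) group of length `n` has at most `X ^ n` subgroups of index at most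
`X`. -/
theorem IsPolyInt.finite_and_ncard_le {n : ℕ} {G : Type*} [Group G] (h : IsPolyInt n G) (X : ℕ) :
    (subgroupsLE G X).Finite ∧ (subgroupsLE G X).ncard ≤ X ^ n := by
  induction n generalizing G with
  | zero =>
    have : Subsingleton G := h
    exact ⟨Set.toFinite _, (Set.ncard_le_one_of_subsingleton _).trans (by simp)⟩
  | succ n ih =>
    obtain ⟨f, hf, hk⟩ := h
    obtain ⟨hfin, hcard⟩ := ih hk
    have h1 := finite_and_ncard_le_sum_of_isGeneratedBy hf isGeneratedBy_one_of_isCyclic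
      (S := subgroupsLE G X) subset_rfl hfin.toFinset ?_ (fun _ ↦ ⊤) (fun _ _ ↦ le_top) ?_ ?_
    · refine ⟨h1.1, h1.2.trans ?_⟩
      rw [Set.ncard_eq_toFinset_card _ hfin] at hcard
      simpa [pow_succ] using Nat.mul_le_mul_right X hcard
    · intro H hH
      rw [Set.Finite.mem_toFinset]
      have h2 := index_eq_map_mul_subgroupOf_ker hf H
      refine ⟨fun h0 ↦ hH.1 (by rw [h2, h0, mul_zero]), le_trans ?_ hH.2⟩
      rw [h2]
      exact Nat.le_mul_of_pos_left _ (Nat.pos_of_ne_zero fun h0 ↦ hH.1 (by rw [h2, h0, zero_mul]))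
    · intro B hB
      rw [Set.Finite.mem_toFinset] at hB
      exact hB.1
    · intro B hB Y
      simpa using multiplicative_int_finite_and_ncard_le Y

theorem IsPolyInt.finite_and_ncard_le_of_le {n : ℕ} {G : Type*} [Group G] (h : IsPolyInt n G)
    {L : Subgroup G} (hL : L.index ≠ 0) (Y : ℕ) :
    {A ∈ subgroupsLE G Y | A ≤ L}.Finite ∧
      {A ∈ subgroupsLE G Y | A ≤ L}.ncard ≤ (Y / L.index) ^ n := by
  obtain ⟨hfin, hcard⟩ := (h.of_index_ne_zero hL).finite_and_ncard_le (Y / L.index)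
  have hmaps : Set.MapsTo (fun A : Subgroup G ↦ A.subgroupOf L) {A ∈ subgroupsLE G Y | A ≤ L}
      (subgroupsLE L (Y / L.index)) := by
    rintro A ⟨hA, hAL⟩
    have h1 : (A.subgroupOf L).index * L.index = A.index := relIndex_mul_index hAL
    refine ⟨fun h0 ↦ hA.1 (by rw [← h1, h0, zero_mul]), ?_⟩
    rw [Nat.le_div_iff_mul_le (Nat.pos_of_ne_zero hL), h1]
    exact hA.2
  have hinj : Set.InjOn (fun A : Subgroup G ↦ A.subgroupOf L)
      {A ∈ subgroupsLE G Y | A ≤ L} := by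
    rintro A ⟨_, hA⟩ B ⟨_, hB⟩ h
    simpa [inf_eq_left.2 hA, inf_eq_left.2 hB] using subgroupOf_inj.1 h
  exact ⟨Set.Finite.of_injOn hmaps hinj hfin,
    (Set.ncard_le_ncard_of_injOn _ hmaps hinj hfin).trans hcard⟩

/-! ### The index of the trace on a central infinite cyclic subgroup -/

theorem IsPolyInt.finite_and_ncard_le_sum {d X : ℕ} {G Q : Type*} [Group G] [Group Q]
    (hQ : IsPolyInt d Q) {π : G →* Q} (hπ : Function.Surjective π)
    {S : Set (Subgroup G)} (hS : S ⊆ subgroupsLE G X) (𝓑 : Finset (Subgroup π.ker))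
    (hS𝓑 : ∀ H ∈ S, H.subgroupOf π.ker ∈ 𝓑) (h𝓑 : ∀ B ∈ 𝓑, B.index ≠ 0)
    (L : Subgroup π.ker → Subgroup Q) (hL0 : ∀ B ∈ 𝓑, (L B).index ≠ 0)
    (hL : ∀ H ∈ S, H.map π ≤ L (H.subgroupOf π.ker)) :
    S.Finite ∧ S.ncard ≤ ∑ B ∈ 𝓑, (X / (L B).index) ^ d :=
  finite_and_ncard_le_sum_of_isGeneratedBy hπ hQ.isGeneratedBy hS 𝓑 hS𝓑 L hL h𝓑
    fun B hB Y ↦ hQ.finite_and_ncard_le_of_le (hL0 B hB) Y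

theorem IsPolyInt.finite_and_ncard_le_card_mul {d X : ℕ} {G Q : Type*} [Group G] [Group Q]
    (hQ : IsPolyInt d Q) {π : G →* Q} (hπ : Function.Surjective π)
    {S : Set (Subgroup G)} (hS : S ⊆ subgroupsLE G X) (𝓑 : Finset (Subgroup π.ker))
    (hS𝓑 : ∀ H ∈ S, H.subgroupOf π.ker ∈ 𝓑) (h𝓑 : ∀ B ∈ 𝓑, B.index ≠ 0) :
    S.Finite ∧ S.ncard ≤ 𝓑.card * X ^ d := by
  simpa using hQ.finite_and_ncard_le_sum hπ hS 𝓑 hS𝓑 h𝓑 (fun _ ↦ ⊤) (by simp) (by simp)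

theorem subgroupOf_ker_mem_subgroupsLE {X : ℕ} {G Q : Type*} [Group G] [Group Q] {π : G →* Q}
    (hπ : Function.Surjective π) {H : Subgroup G} (hH : H ∈ subgroupsLE G X) :
    H.subgroupOf π.ker ∈ subgroupsLE π.ker X := by
  have h2 := index_eq_map_mul_subgroupOf_ker hπ H
  refine ⟨fun h0 ↦ hH.1 (by rw [h2, h0, mul_zero]), le_trans ?_ hH.2⟩
  rw [h2]
  exact Nat.le_mul_of_pos_left _ (Nat.pos_of_ne_zero fun h0 ↦ hH.1 (by rw [h2, h0, zero_mul]))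

theorem isPolyInt_one_of_mulEquiv {G : Type*} [Group G] (e : G ≃* Multiplicative ℤ) :
    IsPolyInt 1 G := by
  refine ⟨e.toMonoidHom, e.surjective, ?_⟩
  rw [(MonoidHom.ker_eq_bot_iff _).2 e.injective]
  exact inferInstanceAs (Subsingleton (⊥ : Subgroup G))

/-- The subgroups of an infinite cyclic group have distinct indices. -/
theorem sum_one_div_index_le_harmonic {G : Type*} [Group G] (e : G ≃* Multiplicative ℤ) {X : ℕ}
    (𝓒 : Finset (Subgroup G)) (h𝓒 : ∀ C ∈ 𝓒, C ∈ subgroupsLE G X) :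
    ∑ C ∈ 𝓒, (1 / C.index : ℝ) ≤ harmonic X := by
  have hinj : Set.InjOn (fun C : Subgroup G ↦ C.index) 𝓒 := by
    intro A _ B _ h
    refine map_injective (f := e.toMonoidHom) e.injective
      (multiplicative_int_subgroup_eq_of_index_eq ?_)
    exact (index_map_equiv A e).trans (h.trans (index_map_equiv B e).symm)
  have hsub : 𝓒.image (fun C ↦ C.index) ⊆ Finset.Icc 1 X := by
    intro i hi
    obtain ⟨C, hC, rfl⟩ := Finset.mem_image.1 hi
    exact Finset.mem_Icc.2 ⟨Nat.pos_of_ne_zero (h𝓒 C hC).1, (h𝓒 C hC).2⟩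
  rw [harmonic_eq_sum_Icc]
  push_cast
  calc ∑ C ∈ 𝓒, (1 / C.index : ℝ)
      = ∑ i ∈ 𝓒.image (fun C : Subgroup G ↦ C.index), ((i : ℕ) : ℝ)⁻¹ := by
        rw [Finset.sum_image (f := fun i : ℕ ↦ (i : ℝ)⁻¹) hinj]; simp
    _ ≤ _ := Finset.sum_le_sum_of_subset_of_nonneg hsub fun _ _ _ ↦ by positivity

/-- A subgroup `A` of finite index meets `⟨x, y⟩`, for commuting `x` and `y`, in a lattice with a
triangular basis whose determinant is at most the index of `A`. -/
theorem exists_triangular_mem {G : Type*} [Group G] {A : Subgroup G} (hA : A.index ≠ 0) {x y : G}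
    (hxy : Commute x y) : ∃ a b : ℕ, ∃ c : ℤ, 0 < a ∧ 0 < b ∧ a * b ≤ A.index ∧
      x ^ a * y ^ c ∈ A ∧ y ^ b ∈ A := by
  classical
  have hb : ∃ b : ℕ, 0 < b ∧ y ^ b ∈ A := by
    obtain ⟨b, hb, -, h⟩ := exists_pow_mem_of_index_ne_zero hA y
    exact ⟨b, hb, h⟩
  have ha : ∃ a : ℕ, 0 < a ∧ ∃ c : ℤ, x ^ a * y ^ c ∈ A := by
    obtain ⟨a, ha, -, h⟩ := exists_pow_mem_of_index_ne_zero hA x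
    exact ⟨a, ha, 0, by simpa using h⟩
  obtain ⟨ha0, c, hc⟩ := Nat.find_spec ha
  obtain ⟨hb0, hb1⟩ := Nat.find_spec hb
  refine ⟨Nat.find ha, Nat.find hb, c, ha0, hb0, ?_, hc, hb1⟩
  have : Finite (G ⧸ A) := index_ne_zero_iff_finite.1 hA
  let F : Fin (Nat.find ha) × Fin (Nat.find hb) → G ⧸ A := fun p ↦
    QuotientGroup.mk (x ^ (p.1 : ℕ) * y ^ (p.2 : ℕ))
  have hdiff : ∀ i j i' j' : ℕ, (x ^ i * y ^ j)⁻¹ * (x ^ i' * y ^ j') =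
      x ^ ((i' : ℤ) - i) * y ^ ((j' : ℤ) - j) := by
    intro i j i' j'
    have h1 : Commute (y ^ (-(j : ℤ))) (x ^ ((i' : ℤ) - i)) := (hxy.symm.zpow_zpow _ _)
    rw [mul_inv_rev, ← zpow_natCast, ← zpow_natCast, ← zpow_natCast, ← zpow_natCast, ← zpow_neg,
      ← zpow_neg, mul_assoc, ← mul_assoc (x ^ _), ← zpow_add, neg_add_eq_sub, ← mul_assoc, h1.eq,
      mul_assoc, ← zpow_add, neg_add_eq_sub]
  -- by minimality of the exponents, distinct monomials lie in distinct cosets of `A`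
  have hi : ∀ i i' : ℕ, i ≤ i' → i' < Nat.find ha → ∀ d : ℤ,
      x ^ ((i' : ℤ) - i) * y ^ d ∈ A → i = i' := by
    intro i i' hle hlt d hd
    by_contra hne
    refine Nat.find_min ha (m := i' - i) (by omega) ⟨by omega, d, ?_⟩
    rwa [← zpow_natCast, Nat.cast_sub hle]
  have hj : ∀ j j' : ℕ, j ≤ j' → j' < Nat.find hb → y ^ ((j' : ℤ) - j) ∈ A → j = j' := by
    intro j j' hle hlt hd
    by_contra hne
    refine Nat.find_min hb (m := j' - j) (by omega) ⟨by omega, ?_⟩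
    rwa [← zpow_natCast, Nat.cast_sub hle]
  have key : ∀ p q : Fin (Nat.find ha) × Fin (Nat.find hb), F p = F q → (p.1 : ℕ) ≤ q.1 →
      (p.1 : ℕ) = q.1 ∧ ((p.2 : ℕ) ≤ q.2 → (p.2 : ℕ) = q.2) := by
    intro p q h hle
    simp only [F] at h
    rw [QuotientGroup.eq, hdiff] at h
    have h1 := hi _ _ hle q.1.2 _ h
    refine ⟨h1, fun hle' ↦ hj _ _ hle' q.2.2 ?_⟩
    simpa [h1] using h
  have hF : Function.Injective F := by
    intro p q h
    have h1 : (p.1 : ℕ) = q.1 := by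
      rcases le_total (p.1 : ℕ) q.1 with h' | h'
      · exact (key p q h h').1
      · exact (key q p h.symm h').1.symm
    have h2 : (p.2 : ℕ) = q.2 := by
      rcases le_total (p.2 : ℕ) q.2 with h' | h'
      · exact (key p q h h1.le).2 h'
      · exact ((key q p h.symm h1.ge).2 h').symm
    exact Prod.ext (Fin.ext h1) (Fin.ext h2)
  simpa [Subgroup.index] using Nat.card_le_card_of_injective F hF

theorem conj_pow_of_commutator_mem_center {N : Type*} [Group N] {x y : N}
    (hw : ⁅x, y⁆ ∈ center N) (a b : ℕ) :
    x ^ a * y ^ b * (x ^ a)⁻¹ = ⁅x, y⁆ ^ (a * b) * y ^ b := by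
  have hc : ∀ g, Commute ⁅x, y⁆ g := fun g ↦ (mem_center_iff.1 hw g).symm
  have h1 : ∀ a : ℕ, x ^ a * y * (x ^ a)⁻¹ = ⁅x, y⁆ ^ a * y := by
    intro a
    induction a with
    | zero => simp
    | succ a ih =>
      have : x * y * x⁻¹ = ⁅x, y⁆ * y := by simp [commutatorElement_def]
      calc x ^ (a + 1) * y * (x ^ (a + 1))⁻¹ = x ^ a * (x * y * x⁻¹) * (x ^ a)⁻¹ := by
            rw [pow_succ]; group
        _ = ⁅x, y⁆ * (x ^ a * y * (x ^ a)⁻¹) := by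
            rw [this, ← mul_assoc, ← (hc (x ^ a)).eq]; group
        _ = _ := by rw [ih, pow_succ', mul_assoc]
  rw [← conj_pow, h1, ((hc y).pow_left a).mul_pow, pow_mul]

/-- Lifting the triangular basis of `exists_triangular_mem` to `H`, the commutator of the two lifts
is `⁅x, y⁆` to the power of the determinant. -/
theorem commutator_pow_mem {N Q : Type*} [Group N] [Group Q] {π : N →* Q}
    (hπ : π.ker ≤ center N) {x y : N} (hw : ⁅x, y⁆ ∈ π.ker) {H : Subgroup N}
    (hH : (H.map π).index ≠ 0) :
    ∃ m : ℕ, 0 < m ∧ m ≤ (H.map π).index ∧ ⁅x, y⁆ ^ m ∈ H := by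
  have hxy : Commute (π x) (π y) := by
    rw [← commutatorElement_eq_one_iff_commute, ← map_commutatorElement]; exact hw
  obtain ⟨a, b, c, ha, hb, hab, ⟨u, hu, hux⟩, v, hv, hvy⟩ := exists_triangular_mem hH hxy
  refine ⟨a * b, Nat.mul_pos ha hb, hab, ?_⟩
  have hcen : ∀ {g g' : N}, π g = π g' → g'⁻¹ * g ∈ center N := fun h ↦
    hπ (by simp [MonoidHom.mem_ker, h])
  have hz := hcen (show π u = π (x ^ a * y ^ c) by simpa using hux)
  have hz' := hcen (show π v = π (y ^ b) by simpa using hvy)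
  obtain ⟨z, hz2⟩ : ∃ z, (x ^ a * y ^ c)⁻¹ * u = z := ⟨_, rfl⟩
  obtain ⟨z', hz2'⟩ : ∃ z', (y ^ b)⁻¹ * v = z' := ⟨_, rfl⟩
  rw [hz2] at hz
  rw [hz2'] at hz'
  rw [inv_mul_eq_iff_eq_mul] at hz2 hz2'
  have h1 : ⁅x, y⁆ ^ (a * b) * v = u * v * u⁻¹ := by
    symm
    have hyc : Commute (y ^ c) (y ^ b) := ((Commute.refl y).zpow_left c).pow_right b
    calc u * v * u⁻¹ = x ^ a * (y ^ c * (z * (y ^ b * z')) * z⁻¹ * (y ^ c)⁻¹) * (x ^ a)⁻¹ := by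
          rw [hz2, hz2']; group
      _ = x ^ a * (y ^ c * y ^ b * z' * (y ^ c)⁻¹) * (x ^ a)⁻¹ := by
          rw [← mem_center_iff.1 hz]; group
      _ = x ^ a * y ^ b * (z' * (x ^ a)⁻¹) := by
          rw [hyc.eq, mul_assoc (y ^ b * _), ← mem_center_iff.1 hz']; group
      _ = x ^ a * y ^ b * (x ^ a)⁻¹ * z' := by
          rw [← mem_center_iff.1 hz']; group
      _ = _ := by rw [conj_pow_of_commutator_mem_center (hπ hw), hz2', mul_assoc]
  rw [← eq_mul_inv_iff_mul_eq] at h1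
  rw [h1]
  exact H.mul_mem (H.mul_mem (H.mul_mem hu hv) (H.inv_mem hu)) (H.inv_mem hv)

section Bounds

variable {N Q R : Type*} [Group N] [Group Q] [Group R] {q t : ℕ} {π : N →* Q}
  {ρ : π.ker →* R} {w : ρ.ker} {x y : N}

theorem index_le_of_pow_mem {Z : Type*} [Group Z] (e : Z ≃* Multiplicative ℤ) {w : Z}
    (hw : w ≠ 1) {C : Subgroup Z} {m : ℕ} (hm : 0 < m) (hC : w ^ m ∈ C) :
    C.index ≤ (e w).toAdd.natAbs * m := by
  have h1 : e w ≠ 1 := by simpa using hw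
  have h2 : (e w) ^ m ≠ 1 := by
    rw [← toAdd_eq_zero.ne, toAdd_pow, smul_ne_zero_iff]
    exact ⟨hm.ne', by simpa using h1⟩
  have h3 : (e w) ^ m ∈ C.map e.toMonoidHom := ⟨_, hC, by simp⟩
  have h4 := (multiplicative_int_index_le h2 h3).2
  rw [toAdd_pow, nsmul_eq_mul, Int.natAbs_mul, Int.natAbs_natCast, mul_comm] at h4
  exact (index_map_equiv C e).symm.trans_le h4

/-- Since the trace of `H` on the infinite cyclic group `ρ.ker` has index bounded both by
a multiple of `(H.map π).index` and by the index of the trace of `H` on `π.ker`, it is bounded by a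
multiple of the square root of the index of `H`. -/
theorem finite_and_ncard_subgroupsLE_le (hQ : IsPolyInt q Q) (hR : IsPolyInt t R)
    (hπ : Function.Surjective π) (hρ : Function.Surjective ρ) (hcen : π.ker ≤ center N)
    (e : ρ.ker ≃* Multiplicative ℤ) (hw : w ≠ 1) (hxy : ⁅x, y⁆ = ((w : π.ker) : N)) (X : ℕ) :
    (subgroupsLE N X).Finite ∧
    (subgroupsLE N X).ncard ≤ Nat.sqrt ((e w).toAdd.natAbs * X) * X ^ t * X ^ q := by
  set k := (e w).toAdd.natAbs with hk
  obtain ⟨hfin, hcard⟩ :=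
    (isPolyInt_one_of_mulEquiv e).finite_and_ncard_le (Nat.sqrt (k * X))
  rw [Set.ncard_eq_toFinset_card _ hfin, pow_one] at hcard
  have h1 := hR.finite_and_ncard_le_card_mul hρ (X := X)
    (S := {B | B ∈ subgroupsLE π.ker X ∧ B.subgroupOf ρ.ker ∈ hfin.toFinset})
    (fun B hB ↦ hB.1) hfin.toFinset (fun B hB ↦ hB.2) (fun C hC ↦ (hfin.mem_toFinset.1 hC).1)
  obtain ⟨hfin1, hcard1⟩ := h1
  rw [Set.ncard_eq_toFinset_card _ hfin1] at hcard1
  have h2 := hQ.finite_and_ncard_le_card_mul hπ (S := subgroupsLE N X) subset_rfl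
    hfin1.toFinset ?_ (fun B hB ↦ (hfin1.mem_toFinset.1 hB).1.1)
  · exact ⟨h2.1, h2.2.trans (Nat.mul_le_mul_right _ (hcard1.trans (Nat.mul_le_mul_right _ hcard)))⟩
  · intro H hH
    have hB := subgroupOf_ker_mem_subgroupsLE hπ hH
    have hC := subgroupOf_ker_mem_subgroupsLE hρ ⟨hB.1, le_rfl⟩
    rw [Set.Finite.mem_toFinset]
    refine ⟨hB, ?_⟩
    rw [Set.Finite.mem_toFinset]
    refine ⟨hC.1, Nat.le_sqrt.2 ?_⟩
    have hidx := index_eq_map_mul_subgroupOf_ker hπ H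
    obtain ⟨m, hm0, hm, hmH⟩ := commutator_pow_mem (x := x) (y := y) (H := H) hcen
      (by rw [hxy]; exact (w : π.ker).2) (fun h0 ↦ hH.1 (by rw [hidx, h0, zero_mul]))
    have h3 := index_le_of_pow_mem e hw hm0
      (C := (H.subgroupOf π.ker).subgroupOf ρ.ker) (by
        rw [hxy] at hmH
        exact hmH)
    calc _ ≤ k * m * (H.subgroupOf π.ker).index := Nat.mul_le_mul h3 hC.2
      _ ≤ k * (H.map π).index * (H.subgroupOf π.ker).index := by gcongr
      _ = k * H.index := by rw [mul_assoc, hidx]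
      _ ≤ k * X := Nat.mul_le_mul_left _ hH.2

/-- If `y` is central modulo the centre, then a normal subgroup `H` contains all `⁅v, y⁆` with
`v ∈ H`; hence its image in `Q` lies in a subgroup whose index is at least a multiple of the index
of the trace of `H` on `ρ.ker`. -/
theorem finite_and_ncard_normal_le (hQ : IsPolyInt q Q) (hq : q ≠ 0) (hR : IsPolyInt t R)
    (hπ : Function.Surjective π) (hρ : Function.Surjective ρ)
    (e : ρ.ker ≃* Multiplicative ℤ) (hw : w ≠ 1) (hxy : ⁅x, y⁆ = ((w : π.ker) : N))
    (ψ : Q →* π.ker) (hψ : ∀ v, (ψ (π v) : N) = ⁅v, y⁆) (X : ℕ) :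
    {H ∈ subgroupsLE N X | H.Normal}.Finite ∧
    ({H ∈ subgroupsLE N X | H.Normal}.ncard : ℝ) ≤
      (e w).toAdd.natAbs * X ^ q * X ^ t * harmonic X := by
  classical
  set k := (e w).toAdd.natAbs with hk
  have hfinB := (((isPolyInt_one_of_mulEquiv e).of_extension hρ hR).finite_and_ncard_le X).1
  have hfinC := ((isPolyInt_one_of_mulEquiv e).finite_and_ncard_le X).1
  have hL0 : ∀ B ∈ hfinB.toFinset, (B.comap ψ).index ≠ 0 := fun B hB ↦ by
    rw [index_comap]
    exact fun h0 ↦ (hfinB.mem_toFinset.1 hB).1 (index_eq_zero_of_relIndex_eq_zero h0)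
  have h1 := hQ.finite_and_ncard_le_sum hπ (X := X) (S := {H ∈ subgroupsLE N X | H.Normal})
    (fun H hH ↦ hH.1) hfinB.toFinset
    (fun H hH ↦ hfinB.mem_toFinset.2 (subgroupOf_ker_mem_subgroupsLE hπ hH.1))
    (fun B hB ↦ (hfinB.mem_toFinset.1 hB).1) (fun B ↦ B.comap ψ) hL0 ?_
  · refine ⟨h1.1, (Nat.cast_le.2 h1.2).trans ?_⟩
    -- each term is bounded in terms of the trace on the infinite cyclic group
    have hterm : ∀ B ∈ hfinB.toFinset, (((X / (B.comap ψ).index) ^ q : ℕ) : ℝ) ≤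
        k * X ^ q * (1 / (B.subgroupOf ρ.ker).index) := by
      intro B hB
      have hl := hL0 B hB
      have hC := subgroupOf_ker_mem_subgroupsLE hρ (hfinB.mem_toFinset.1 hB)
      obtain ⟨j, hj0, hj, hjB⟩ := exists_pow_mem_of_index_ne_zero hl (π x)
      have hψx : ψ (π x) = (w : π.ker) := Subtype.ext ((hψ x).trans hxy)
      have hm := index_le_of_pow_mem e hw hj0 (C := B.subgroupOf ρ.ker) (by
        rw [mem_comap, map_pow, hψx] at hjB
        exact hjB)
      have hm' : (B.subgroupOf ρ.ker).index ≤ k * (B.comap ψ).index :=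
        hm.trans (Nat.mul_le_mul_left _ hj)
      have hCpos : (0 : ℝ) < (B.subgroupOf ρ.ker).index :=
        Nat.cast_pos.2 (Nat.pos_of_ne_zero hC.1)
      have hlpos : (0 : ℝ) < (B.comap ψ).index := Nat.cast_pos.2 (Nat.pos_of_ne_zero hl)
      have h2 : (1 : ℝ) / (B.comap ψ).index ≤ k * (1 / (B.subgroupOf ρ.ker).index) := by
        rw [mul_one_div, div_le_div_iff₀ hlpos hCpos, one_mul]
        exact_mod_cast hm'
      obtain ⟨q', rfl⟩ := Nat.exists_eq_succ_of_ne_zero hq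
      have hdiv : ((X / (B.comap ψ).index : ℕ) : ℝ) ≤ X * (1 / (B.comap ψ).index) := by
        rw [mul_one_div]; exact Nat.cast_div_le
      have hdiv' : ((X / (B.comap ψ).index : ℕ) : ℝ) ≤ X := Nat.cast_le.2 (Nat.div_le_self _ _)
      calc (((X / (B.comap ψ).index) ^ (q' + 1) : ℕ) : ℝ)
          = ((X / (B.comap ψ).index : ℕ) : ℝ) ^ q' * ((X / (B.comap ψ).index : ℕ) : ℝ) := by
            push_cast [pow_succ]; rfl
        _ ≤ (X : ℝ) ^ q' * (X * (k * (1 / (B.subgroupOf ρ.ker).index))) := by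
            gcongr
            exact hdiv.trans (by gcongr)
        _ = _ := by rw [Nat.succ_eq_add_one]; ring
    have hmaps : ∀ B ∈ hfinB.toFinset, B.subgroupOf ρ.ker ∈ hfinC.toFinset := fun B hB ↦
      hfinC.mem_toFinset.2 (subgroupOf_ker_mem_subgroupsLE hρ (hfinB.mem_toFinset.1 hB))
    have hfib : ∀ C ∈ hfinC.toFinset,
        ((hfinB.toFinset.filter fun B ↦ B.subgroupOf ρ.ker = C).card : ℝ) ≤ X ^ t := by
      intro C hC
      have h3 := hR.finite_and_ncard_le_card_mul hρ (X := X)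
        (S := ↑(hfinB.toFinset.filter fun B ↦ B.subgroupOf ρ.ker = C))
        (fun B hB ↦ hfinB.mem_toFinset.1 (Finset.mem_filter.1 hB).1) {C}
        (fun B hB ↦ by simpa using (Finset.mem_filter.1 hB).2)
        (by simpa using (hfinC.mem_toFinset.1 hC).1)
      have h4 := h3.2
      rw [Set.ncard_coe_finset, Finset.card_singleton, one_mul] at h4
      exact_mod_cast h4
    calc ((∑ B ∈ hfinB.toFinset, (X / (B.comap ψ).index) ^ q : ℕ) : ℝ)
        ≤ ∑ B ∈ hfinB.toFinset, (k * X ^ q * (1 / (B.subgroupOf ρ.ker).index) : ℝ) := by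
          rw [Nat.cast_sum]; exact Finset.sum_le_sum hterm
      _ = ∑ C ∈ hfinC.toFinset, ∑ B ∈ hfinB.toFinset with B.subgroupOf ρ.ker = C,
            (k * X ^ q * (1 / (B.subgroupOf ρ.ker).index) : ℝ) :=
          (Finset.sum_fiberwise_of_maps_to hmaps _).symm
      _ ≤ ∑ C ∈ hfinC.toFinset, (k * X ^ q * X ^ t * (1 / C.index) : ℝ) := by
          refine Finset.sum_le_sum fun C hC ↦ ?_
          rw [Finset.sum_congr rfl (g := fun _ ↦ (k * X ^ q * (1 / C.index) : ℝ))
            fun B hB ↦ by rw [(Finset.mem_filter.1 hB).2], Finset.sum_const, nsmul_eq_mul]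
          calc _ ≤ (X : ℝ) ^ t * (k * X ^ q * (1 / C.index)) := by
                gcongr; exact hfib C hC
            _ = _ := by ring
      _ ≤ _ := by
          rw [← Finset.mul_sum]
          gcongr
          exact sum_one_div_index_le_harmonic e _ fun C hC ↦ hfinC.mem_toFinset.1 hC
  · rintro H ⟨-, hH⟩ _ ⟨v, hv, rfl⟩
    rw [mem_comap, mem_subgroupOf, hψ, commutatorElement_def, mul_assoc, mul_assoc]
    refine H.mul_mem hv ?_
    rw [← mul_assoc]
    exact hH.conj_mem _ (H.inv_mem hv) y

end Bounds

/-! ### Hirsch length -/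

/-- `A ≤ B` is normal in `B` with infinite cyclic quotient. -/
def HasIntQuotient {G : Type*} [Group G] (A B : Subgroup G) : Prop :=
  A ≤ B ∧ ∃ g : B →* Multiplicative ℤ, Function.Surjective g ∧ g.ker = A.subgroupOf B

theorem HasIntQuotient.map {G G' : Type*} [Group G] [Group G'] {f : G →* G'}
    (hf : Function.Injective f) {A B : Subgroup G} (h : HasIntQuotient A B) :
    HasIntQuotient (A.map f) (B.map f) := by
  obtain ⟨hle, g, hg, hgk⟩ := h
  let e := B.equivMapOfInjective f hf
  refine ⟨map_mono hle, g.comp e.symm.toMonoidHom, hg.comp e.symm.surjective, ?_⟩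
  ext x
  obtain ⟨y, rfl⟩ := e.surjective x
  have h1 : g y = 1 ↔ (y : G) ∈ A := by
    rw [← MonoidHom.mem_ker, hgk, mem_subgroupOf]
  simp only [MonoidHom.mem_ker, MonoidHom.comp_apply, MulEquiv.coe_toMonoidHom,
    MulEquiv.symm_apply_apply, mem_subgroupOf, h1, e, coe_equivMapOfInjective_apply]
  exact (mem_map_iff_mem hf).symm

theorem exists_series_of_isPolyInt {n : ℕ} {G : Type*} [Group G] (h : IsPolyInt n G) :
    ∃ H : ℕ → Subgroup G, H 0 = ⊥ ∧ H n = ⊤ ∧ ∀ i < n, HasIntQuotient (H i) (H (i + 1)) := by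
  induction n generalizing G with
  | zero =>
    have : Subsingleton G := h
    exact ⟨fun _ ↦ ⊥, rfl, Subsingleton.elim _ _, fun i hi ↦ absurd hi (Nat.not_lt_zero i)⟩
  | succ n ih =>
    obtain ⟨f, hf, hk⟩ := h
    obtain ⟨H, hH0, hHn, hH⟩ := ih hk
    refine ⟨fun i ↦ if i ≤ n then (H i).map f.ker.subtype else ⊤, by simp [hH0], by simp,
      fun i hi ↦ ?_⟩
    beta_reduce
    rcases (Nat.lt_succ_iff.1 hi).lt_or_eq with hlt | rfl
    · rw [if_pos hlt.le, if_pos (Nat.succ_le_of_lt hlt)]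
      exact (hH i hlt).map f.ker.subtype_injective
    · rw [if_pos le_rfl, if_neg (Nat.not_succ_le_self i), hHn]
      refine ⟨le_top, f.comp (⊤ : Subgroup G).subtype,
        hf.comp fun x ↦ ⟨⟨x, mem_top x⟩, rfl⟩, ?_⟩
      ext x
      simp [MonoidHom.mem_ker, mem_subgroupOf]

theorem IsPolyInt.hasHirschLength {n : ℕ} {G : Type*} [Group G] (h : IsPolyInt n G) :
    HasHirschLength G n := by
  obtain ⟨H, hH0, hHn, hH⟩ := exists_series_of_isPolyInt h
  have key : ∀ i < n, ∃ _ : ((H i).subgroupOf (H (i + 1))).Normal,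
      IsCyclic (↥(H (i + 1)) ⧸ (H i).subgroupOf (H (i + 1))) ∧
      Infinite (↥(H (i + 1)) ⧸ (H i).subgroupOf (H (i + 1))) := by
    intro i hi
    obtain ⟨-, g, hg, hgk⟩ := hH i hi
    rw [← hgk]
    let e := QuotientGroup.quotientKerEquivOfSurjective g hg
    exact ⟨inferInstance, isCyclic_of_surjective e.symm e.symm.surjective,
      Infinite.of_injective _ e.symm.injective⟩
  refine ⟨n, H, hH0, hHn, fun i hi ↦ (hH i hi).1,
    fun i hi ↦ ⟨(key i hi).1, (key i hi).2.1⟩, ?_⟩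
  have : {i : ℕ | i < n ∧ Infinite (↥(H (i + 1)) ⧸ (H i).subgroupOf (H (i + 1)))} =
      (Finset.range n : Finset ℕ) := by
    ext i
    simpa using fun hi ↦ (key i hi).2.2
  rw [this, Set.ncard_coe_finset, Finset.card_range]

theorem index_ne_zero_of_card_eq_zero {C : Type*} [Group C] [IsCyclic C] {D : Subgroup C}
    (hD : Nat.card D = 0) : D.index ≠ 0 := by
  have hDinf : Infinite D := by
    by_contra h
    rw [not_infinite_iff_finite] at h
    exact Nat.card_pos.ne' hD
  have : Infinite C := Infinite.of_injective _ D.subtype_injective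
  obtain ⟨e⟩ := nonempty_mulEquiv_multiplicative_int C
  obtain ⟨w, hw⟩ := exists_ne (1 : D)
  have h1 : e w ≠ 1 := by simpa using hw
  rw [← index_map_equiv D e]
  exact (multiplicative_int_index_le h1 (mem_map_of_mem _ w.2)).1

theorem index_ne_zero_of_relIndex_ker_ne_zero {M C : Type*} [Group M] [Group C] [IsCyclic C]
    {γ : M →* C} {K : Subgroup M} (h0 : γ.ker.relIndex K = 0) (hK : K.relIndex γ.ker ≠ 0) :
    K.index ≠ 0 := by
  rw [relIndex_ker] at h0
  have h1 : (K ⊔ γ.ker).index ≠ 0 := by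
    rw [← comap_map_eq, index_comap]
    exact fun h ↦ index_ne_zero_of_card_eq_zero h0 (index_eq_zero_of_relIndex_eq_zero h)
  rw [← relIndex_sup_of_normal] at hK
  rw [← relIndex_top_right] at h1 ⊢
  exact relIndex_ne_zero_trans hK h1

section Series

variable {G : Type*} [Group G]

open Classical in
/-- The Hirsch length of a subgroup `K`, computed from a subnormal series `H` of the group: the
number of the first `n` factors in which `K` has an infinite trace. -/
noncomputable def traceLength (n : ℕ) (H : ℕ → Subgroup G) (K : Subgroup G) : ℕ :=
  ((Finset.range n).filter fun i ↦ (H i).relIndex (K ⊓ H (i + 1)) = 0).card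

variable {n : ℕ} {H : ℕ → Subgroup G}

theorem filter_trace_mono {K L : Subgroup G} (hKL : K ≤ L) {i : ℕ}
    (h : (H i).relIndex (K ⊓ H (i + 1)) = 0) : (H i).relIndex (L ⊓ H (i + 1)) = 0 :=
  relIndex_eq_zero_of_le_right (inf_le_inf_right _ hKL) h

theorem traceLength_mono {K L : Subgroup G} (hKL : K ≤ L) :
    traceLength n H K ≤ traceLength n H L :=
  Finset.card_le_card (Finset.monotone_filter_right _ fun _ _ ↦ filter_trace_mono hKL)

/-- If `L` has no more infinite traces than its subgroup `K`, then `K` has finite index in `L`: an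
infinite trace of `K` on a cyclic factor has finite index in that factor. -/
theorem relIndex_ne_zero_of_traceLength_le (hH0 : H 0 = ⊥) (hHn : H n = ⊤)
    (hH : ∀ i < n, H i ≤ H (i + 1) ∧ ∃ _ : ((H i).subgroupOf (H (i + 1))).Normal,
      IsCyclic (↥(H (i + 1)) ⧸ (H i).subgroupOf (H (i + 1))))
    {K L : Subgroup G} (hKL : K ≤ L) (h : traceLength n H L ≤ traceLength n H K) :
    K.relIndex L ≠ 0 := by
  classical
  have heq := Finset.eq_of_subset_of_card_le
    (Finset.monotone_filter_right (Finset.range n) fun _ _ ↦ filter_trace_mono (H := H) hKL) h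
  have hind : ∀ i ≤ n, K.relIndex (L ⊓ H i) ≠ 0 := by
    intro i
    induction i with
    | zero => intro _; simp [hH0]
    | succ i ih =>
      intro hi
      have hi' : i < n := hi
      have ih := ih hi'.le
      obtain ⟨hle, hnor, hcyc⟩ := hH i hi'
      have hinf : (L ⊓ H (i + 1)) ⊓ H i = L ⊓ H i := by
        rw [inf_assoc, inf_eq_right.2 hle]
      by_cases hL : (H i).relIndex (L ⊓ H (i + 1)) = 0
      · have hK : (H i).relIndex (K ⊓ H (i + 1)) = 0 := by
          have : i ∈ (Finset.range n).filter fun i ↦ (H i).relIndex (L ⊓ H (i + 1)) = 0 :=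
            Finset.mem_filter.2 ⟨Finset.mem_range.2 hi', hL⟩
          rw [← heq] at this
          exact (Finset.mem_filter.1 this).2
        -- inside `M`, the trace of `K` on the kernel of `γ` and the image of `K` under `γ` both have
        -- finite index
        set M := L ⊓ H (i + 1) with hM
        let γ : M →* (H (i + 1)) ⧸ (H i).subgroupOf (H (i + 1)) :=
          (QuotientGroup.mk' _).comp (inclusion inf_le_right)
        have hγ : γ.ker = (H i).subgroupOf M := by
          rw [← MonoidHom.comap_ker, QuotientGroup.ker_mk']
          rfl
        have h1 : (K.subgroupOf M).index ≠ 0 := by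
          refine index_ne_zero_of_relIndex_ker_ne_zero (γ := γ) ?_ ?_
          · rw [hγ]
            have h2 : (K ⊓ H (i + 1)).subgroupOf M = K.subgroupOf M := by
              ext x
              simpa [mem_subgroupOf] using fun _ ↦ x.2.2
            rw [← h2, relIndex_subgroupOf (inf_le_inf_right _ hKL)]
            exact hK
          · rw [hγ, ← inf_subgroupOf_left (H i) M, relIndex_subgroupOf inf_le_left, hinf]
            exact ih
        exact h1
      · refine relIndex_ne_zero_trans ih ?_
        rwa [← hinf, inf_relIndex_left]
  simpa [hHn] using hind n le_rfl

end Series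

/-- The `traceLength` for one series of the terms of another increases strictly at each infinite
factor of the latter. -/
theorem HasHirschLength.le {G : Type*} [Group G] {h h' : ℕ} (hG : HasHirschLength G h)
    (hG' : HasHirschLength G h') : h' ≤ h := by
  classical
  obtain ⟨n, H, hH0, hHn, hHle, hHc, hcard⟩ := hG
  obtain ⟨n', H', -, hHn', hHle', -, hcard'⟩ := hG'
  have hinf : ∀ (n : ℕ) (H : ℕ → Subgroup G),
      {i : ℕ | i < n ∧ Infinite (↥(H (i + 1)) ⧸ (H i).subgroupOf (H (i + 1)))} =
      ((Finset.range n).filter fun i ↦ (H i).relIndex (H (i + 1)) = 0 : Finset ℕ) := by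
    intro n H
    ext i
    rw [Finset.mem_coe, Finset.mem_filter, Finset.mem_range, relIndex, index_eq_zero_iff_infinite]
    rfl
  rw [hinf, Set.ncard_coe_finset] at hcard hcard'
  have key : ∀ j ≤ n', ((Finset.range j).filter fun i ↦ (H' i).relIndex (H' (i + 1)) = 0).card ≤
      traceLength n H (H' j) := by
    intro j
    induction j with
    | zero => simp
    | succ j ih =>
      intro hj
      have hle := hHle' j hj
      have ih := ih (Nat.le_of_succ_le hj)
      rw [Finset.range_add_one, Finset.filter_insert]
      split_ifs with h0
      · refine (Finset.card_insert_le _ _).trans (Nat.succ_le_of_lt (ih.trans_lt ?_))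
        by_contra! hlt
        exact relIndex_ne_zero_of_traceLength_le hH0 hHn (fun i hi ↦ ⟨hHle i hi, hHc i hi⟩)
          hle hlt h0
      · exact ih.trans (traceLength_mono hle)
  have h1 := key n' le_rfl
  rw [hcard', hHn'] at h1
  refine h1.trans (le_of_eq ?_)
  rw [← hcard]
  simp [traceLength]

theorem HasHirschLength.unique {G : Type*} [Group G] {h h' : ℕ} (hG : HasHirschLength G h)
    (hG' : HasHirschLength G h') : h = h' :=
  le_antisymm (hG'.le hG) (hG.le hG')

theorem isGeneratedBy_of_map {G G' : Type*} [Group G] [Group G'] {f : G →* G'}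
    (hf : Function.Injective f) {A : Subgroup G} {d : ℕ} (h : IsGeneratedBy (A.map f) d) :
    IsGeneratedBy A d := by
  obtain ⟨s, hs⟩ := h
  have : ∀ i, ∃ a ∈ A, f a = s i := fun i ↦ by
    have : s i ∈ A.map f := by rw [← hs]; exact subset_closure ⟨i, rfl⟩
    exact this
  choose t _ ht using this
  refine ⟨t, map_injective hf ?_⟩
  rw [MonoidHom.map_closure, ← hs, ← Set.range_comp]
  exact congrArg _ (congrArg _ (funext ht))

theorem HasHirschLength.exists_isGeneratedBy {G : Type*} [Group G] {h : ℕ}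
    (hG : HasHirschLength G h) (K : Subgroup G) : ∃ d, IsGeneratedBy K d := by
  obtain ⟨n, H, hH0, hHn, hHle, hHc, -⟩ := hG
  have key : ∀ i ≤ n, ∀ K ≤ H i, ∃ d, IsGeneratedBy K d := by
    intro i
    induction i with
    | zero =>
      intro _ K hK
      rw [hH0, le_bot_iff] at hK
      exact ⟨0, Fin.elim0, by simp [hK]⟩
    | succ i ih =>
      intro hi K hK
      obtain ⟨hnor, hcyc⟩ := hHc i hi
      set T := H (i + 1)
      let γ := QuotientGroup.mk' ((H i).subgroupOf T)
      obtain ⟨d, hd⟩ := ih (Nat.le_of_succ_le hi) (K ⊓ H i) inf_le_right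
      have hγ : γ.ker = (H i).subgroupOf T := QuotientGroup.ker_mk' _
      have h1 : IsGeneratedBy ((K.subgroupOf T).subgroupOf γ.ker) d := by
        refine isGeneratedBy_of_map γ.ker.subtype_injective
          (isGeneratedBy_of_map T.subtype_injective ?_)
        rw [subgroupOf_map_subtype, hγ, subgroupOf, subgroupOf, ← comap_inf, ← subgroupOf,
          subgroupOf_map_subtype,
          inf_eq_left.2 (inf_le_left.trans hK)]
        exact hd
      have h2 := h1.of_extension (isGeneratedBy_one_of_isCyclic _)
      obtain ⟨s, hs⟩ := h2
      refine ⟨d + 1, fun i ↦ s i, ?_⟩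
      have h3 := congrArg (map T.subtype) hs
      rw [subgroupOf_map_subtype, inf_eq_left.2 hK, MonoidHom.map_closure, ← Set.range_comp] at h3
      exact h3
  exact key n le_rfl K (hHn ▸ le_top)

/-! ### Nilpotent groups without torsion -/

section Torsion

/-- Every element of finite order of `G` is trivial. -/
def HasNoTorsion (G : Type*) [Group G] : Prop :=
  ∀ (g : G) (n : ℕ), n ≠ 0 → g ^ n = 1 → g = 1

/-- Every subgroup of `G` is finitely generated. -/
def HasFGSubgroups (G : Type*) [Group G] : Prop :=
  ∀ K : Subgroup G, ∃ d, IsGeneratedBy K d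

variable {G : Type*} [Group G]

theorem HasNoTorsion.subgroup (h : HasNoTorsion G) (K : Subgroup G) : HasNoTorsion K :=
  fun g n hn hg ↦ Subtype.ext (h g n hn (by simpa using congrArg Subtype.val hg))

theorem HasFGSubgroups.of_surjective {Q : Type*} [Group Q] (h : HasFGSubgroups G) {f : G →* Q}
    (hf : Function.Surjective f) : HasFGSubgroups Q := fun K ↦ by
  obtain ⟨d, s, hs⟩ := h (K.comap f)
  refine ⟨d, f ∘ s, ?_⟩
  rw [Set.range_comp, ← MonoidHom.map_closure, hs, map_comap_eq_self_of_surjective hf]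

theorem HasFGSubgroups.subgroup (h : HasFGSubgroups G) (K : Subgroup G) : HasFGSubgroups K :=
  fun A ↦ by
    obtain ⟨d, hd⟩ := h (A.map K.subtype)
    exact ⟨d, isGeneratedBy_of_map K.subtype_injective hd⟩

theorem commutator_pow_of_mem_center {x y : G} (h : ⁅x, y⁆ ∈ center G) (n : ℕ) :
    ⁅x ^ n, y⁆ = ⁅x, y⁆ ^ n := by
  have := conj_pow_of_commutator_mem_center h n 1
  rw [pow_one, mul_one] at this
  rw [commutatorElement_def (x ^ n), this, mul_inv_cancel_right]

/-- The factors of the upper central series of a group without torsion have no torsion. -/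
theorem HasNoTorsion.mem_upperCentralSeries_of_pow_mem (h : HasNoTorsion G) (i : ℕ) {g : G}
    (hg : g ∈ Subgroup.upperCentralSeries G (i + 1)) {n : ℕ} (hn : n ≠ 0)
    (hgn : g ^ n ∈ Subgroup.upperCentralSeries G i) : g ∈ Subgroup.upperCentralSeries G i := by
  induction i generalizing g with
  | zero =>
    rw [Subgroup.upperCentralSeries_zero, mem_bot] at hgn ⊢
    exact h g n hn hgn
  | succ i ih =>
    rw [Subgroup.mem_upperCentralSeries_succ_iff]
    intro x
    have h1 := Subgroup.mem_upperCentralSeries_succ_iff.1 hg x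
    refine ih h1 ?_
    let f := QuotientGroup.mk' (Subgroup.upperCentralSeries G i)
    have hf : ∀ v, f v = 1 ↔ v ∈ Subgroup.upperCentralSeries G i := fun v ↦
      QuotientGroup.eq_one_iff v
    have hcen : ⁅f g, f x⁆ ∈ center (G ⧸ Subgroup.upperCentralSeries G i) := by
      rw [mem_center_iff]
      intro q
      obtain ⟨v, rfl⟩ := QuotientGroup.mk'_surjective _ q
      have h2 := (hf _).2 (Subgroup.mem_upperCentralSeries_succ_iff.1 h1 v)
      rw [map_commutatorElement, commutatorElement_eq_one_iff_mul_comm,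
        map_commutatorElement] at h2
      exact h2.symm
    have h3 := commutator_pow_of_mem_center hcen n
    rw [← map_commutatorElement, ← map_pow, ← map_commutatorElement, ← map_pow,
      (hf _).2 (Subgroup.mem_upperCentralSeries_succ_iff.1 hgn x)] at h3
    exact (hf _).1 h3.symm

/-- An element with a central nonzero power lies in the centre, by descent along the upper central
series. -/
theorem HasNoTorsion.quotient_center [Group.IsNilpotent G] (h : HasNoTorsion G) :
    HasNoTorsion (G ⧸ center G) := by
  intro q n hn hq
  obtain ⟨g, rfl⟩ := QuotientGroup.mk_surjective q
  rw [← QuotientGroup.mk_pow, QuotientGroup.eq_one_iff, ← Subgroup.upperCentralSeries_one] at hq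
  rw [QuotientGroup.eq_one_iff, ← Subgroup.upperCentralSeries_one]
  have key : ∀ j, g ∈ Subgroup.upperCentralSeries G (j + 1) →
      g ∈ Subgroup.upperCentralSeries G 1 := by
    intro j
    induction j with
    | zero => exact id
    | succ j ih =>
      exact fun hg ↦ ih (h.mem_upperCentralSeries_of_pow_mem _ hg hn
        (Subgroup.upperCentralSeries_mono G (Nat.le_add_left 1 j) hq))
  refine key (Group.nilpotencyClass G) (Subgroup.upperCentralSeries_mono G (Nat.le_succ _) ?_)
  rw [Subgroup.upperCentralSeries_nilpotencyClass]
  exact mem_top g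

theorem exists_mulEquiv_of_commGroup {A : Type*} [CommGroup A] (h : HasNoTorsion A)
    (hfg : HasFGSubgroups A) : ∃ n : ℕ, Nonempty (A ≃* Multiplicative (Fin n → ℤ)) := by
  have hfin : Module.Finite ℤ (Additive A) := by
    obtain ⟨d, s, hs⟩ := hfg ⊤
    rw [Module.Finite.iff_addGroup_fg, ← GroupFG.iff_add_fg, Group.fg_def]
    exact ⟨(Set.finite_range s).toFinset, by simpa using hs⟩
  have htf : IsMulTorsionFree A := ⟨fun n hn a b hab ↦ by
    have : (a * b⁻¹) ^ n = 1 := by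
      rw [mul_pow, inv_pow, mul_inv_eq_one]; exact hab
    exact mul_inv_eq_one.1 (h _ n hn this)⟩
  let b := Module.finBasis ℤ (Additive A)
  exact ⟨_, ⟨AddEquiv.toMultiplicativeRight b.equivFun.toAddEquiv⟩⟩

theorem isPolyInt_multiplicative_pi (n : ℕ) : IsPolyInt n (Multiplicative (Fin n → ℤ)) := by
  induction n with
  | zero => exact inferInstanceAs (Subsingleton (Fin 0 → ℤ))
  | succ n ih =>
    let f : Multiplicative (Fin (n + 1) → ℤ) →* Multiplicative ℤ :=
      (Pi.evalAddMonoidHom (fun _ : Fin (n + 1) ↦ ℤ) 0).toMultiplicative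
    refine ⟨f, fun z ↦ ⟨Multiplicative.ofAdd fun _ ↦ z.toAdd, rfl⟩, ih.of_mulEquiv ?_⟩
    have hf : ∀ v : Fin n → ℤ,
        f (Multiplicative.ofAdd (Fin.cons 0 v : Fin (n + 1) → ℤ)) = 1 := fun v ↦ rfl
    exact
      { toFun := fun v ↦ ⟨Multiplicative.ofAdd (Fin.cons 0 v.toAdd : Fin (n + 1) → ℤ), hf _⟩
        invFun := fun v ↦ Multiplicative.ofAdd
          (Fin.tail (v : Multiplicative (Fin (n + 1) → ℤ)).toAdd)
        left_inv := fun v ↦ rfl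
        right_inv := fun v ↦ by
          have h0 : (v : Multiplicative (Fin (n + 1) → ℤ)).toAdd 0 = 0 := v.2
          refine Subtype.ext ?_
          change Multiplicative.ofAdd (Fin.cons 0
            (Fin.tail (v : Multiplicative (Fin (n + 1) → ℤ)).toAdd) :
            Fin (n + 1) → ℤ) = v
          rw [← h0, Fin.cons_self_tail]
          rfl
        map_mul' := fun v w ↦ by
          refine Subtype.ext ?_
          change Multiplicative.ofAdd _ = Multiplicative.ofAdd (_ + _)
          congr 1
          funext i
          refine Fin.cases ?_ (fun j ↦ ?_) i <;> simp }

/-- The layers are the free abelian factors of the upper central series. -/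
theorem exists_isPolyInt [Group.IsNilpotent G] (h : HasNoTorsion G) (hfg : HasFGSubgroups G) :
    ∃ n, IsPolyInt n G := by
  revert h hfg
  refine Group.nilpotent_center_quotient_ind
    (P := fun G _ _ ↦ HasNoTorsion G → HasFGSubgroups G → ∃ n, IsPolyInt n G) G
    (fun G _ _ _ _ ↦ ⟨0, ‹_›⟩) fun G _ _ ih h hfg ↦ ?_
  obtain ⟨b, hb⟩ := ih h.quotient_center (hfg.of_surjective (QuotientGroup.mk'_surjective _))
  let _ : CommGroup (center G) :=
    { (inferInstance : Group (center G)) with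
      mul_comm := fun a b ↦ Subtype.ext (mem_center_iff.1 b.2 a) }
  obtain ⟨a, ⟨e⟩⟩ := exists_mulEquiv_of_commGroup (A := center G) (h.subgroup _)
    (hfg.subgroup _)
  refine ⟨a + b, .of_extension (QuotientGroup.mk'_surjective (center G)) ?_ hb⟩
  rw [QuotientGroup.ker_mk']
  exact (isPolyInt_multiplicative_pi a).of_mulEquiv e.symm

/-- The isolator of a nontrivial element `w` of a finitely generated free abelian group is infinite
cyclic with free abelian quotient. -/
theorem exists_isolator {A : Type*} [CommGroup A] (h : HasNoTorsion A) (hfg : HasFGSubgroups A)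
    {w : A} (hw : w ≠ 1) : ∃ Z : Subgroup A, w ∈ Z ∧ Nonempty (Z ≃* Multiplicative ℤ) ∧
      ∃ t, IsPolyInt t (A ⧸ Z) := by
  let Z : Subgroup A :=
    { carrier := {z | ∃ n : ℕ, n ≠ 0 ∧ z ^ n ∈ zpowers w}
      one_mem' := ⟨1, one_ne_zero, by simp⟩
      mul_mem' := by
        rintro a b ⟨n, hn, ha⟩ ⟨m, hm, hb⟩
        refine ⟨n * m, mul_ne_zero hn hm, ?_⟩
        rw [mul_pow, pow_mul, mul_comm n, pow_mul b]
        exact mul_mem (pow_mem ha m) (pow_mem hb n)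
      inv_mem' := by
        rintro a ⟨n, hn, ha⟩
        exact ⟨n, hn, by rw [inv_pow]; exact inv_mem ha⟩ }
  have hwZ : w ∈ Z := ⟨1, one_ne_zero, by simp⟩
  refine ⟨Z, hwZ, ?_, ?_⟩
  · obtain ⟨r, ⟨e⟩⟩ := exists_mulEquiv_of_commGroup (h.subgroup Z) (hfg.subgroup Z)
    have hr1 : r ≤ 1 := by
      by_contra! hr
      -- two coordinate vectors would be commensurable with `w`
      set u : Fin r → ℤ := (e ⟨w, hwZ⟩).toAdd with hu
      have key : ∀ i : Fin r, ∃ n : ℕ, n ≠ 0 ∧ ∃ m : ℤ,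
          m • u = (n : ℤ) • (Pi.single i 1 : Fin r → ℤ) := by
        intro i
        obtain ⟨z, hz⟩ := e.surjective (Multiplicative.ofAdd (Pi.single i 1))
        obtain ⟨n, hn, m, hm⟩ := z.2
        refine ⟨n, hn, m, ?_⟩
        have h1 : (⟨w, hwZ⟩ : Z) ^ m = z ^ n := Subtype.ext (by simpa using hm)
        have h2 := congrArg (fun v ↦ (e v).toAdd) h1
        simpa [hz] using h2
      have hzero : ∀ i j : Fin r, i ≠ j → u j = 0 := by
        intro i j hij
        obtain ⟨n, hn, m, hm⟩ := key i
        have h1 := congrFun hm j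
        have h2 := congrFun hm i
        simp only [Pi.smul_apply, smul_eq_mul, Pi.single_eq_of_ne hij.symm, mul_zero,
          mul_eq_zero] at h1
        simp only [Pi.smul_apply, smul_eq_mul, Pi.single_eq_same, mul_one] at h2
        rcases h1 with rfl | h1
        · simp at h2; omega
        · exact h1
      have hu0 : u = 0 := by
        funext j
        by_cases hj : j = ⟨0, by omega⟩
        · exact hzero ⟨1, hr⟩ j (by rw [hj]; simp)
        · exact hzero _ j (Ne.symm hj)
      have : e ⟨w, hwZ⟩ = 1 := hu0
      rw [map_eq_one_iff e e.injective] at this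
      exact hw (congrArg Subtype.val this)
    have hr0 : r ≠ 0 := by
      rintro rfl
      have h1 : (⟨w, hwZ⟩ : Z) = 1 := e.injective (Subsingleton.elim (α := Fin 0 → ℤ) _ _)
      exact hw (congrArg Subtype.val h1)
    obtain rfl : r = 1 := by omega
    exact ⟨e.trans (AddEquiv.toMultiplicative (AddEquiv.funUnique (Fin 1) ℤ))⟩
  · have hQ : HasNoTorsion (A ⧸ Z) := by
      intro q n hn hq
      obtain ⟨g, rfl⟩ := QuotientGroup.mk_surjective q
      rw [← QuotientGroup.mk_pow, QuotientGroup.eq_one_iff] at hq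
      obtain ⟨m, hm, hgm⟩ := hq
      rw [QuotientGroup.eq_one_iff]
      exact ⟨n * m, mul_ne_zero hn hm, by rwa [pow_mul]⟩
    exact exists_isPolyInt hQ (hfg.of_surjective (QuotientGroup.mk'_surjective Z))

/-- If `y` is central modulo the centre, then `v ↦ ⁅v, y⁆` is a homomorphism to the centre that
factors through the quotient by the centre. -/
theorem exists_commutator_hom {y : G} (hy : ∀ v : G, ⁅v, y⁆ ∈ center G) :
    ∃ ψ : G ⧸ center G →* (QuotientGroup.mk' (center G)).ker,
      ∀ v, (ψ (QuotientGroup.mk' (center G) v) : G) = ⁅v, y⁆ := by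
  let φ : G →* (QuotientGroup.mk' (center G)).ker := MonoidHom.mk'
    (fun v ↦ ⟨⁅v, y⁆, by rw [QuotientGroup.ker_mk']; exact hy v⟩) fun u v ↦ by
      refine Subtype.ext ?_
      change ⁅u * v, y⁆ = ⁅u, y⁆ * ⁅v, y⁆
      calc ⁅u * v, y⁆ = u * ⁅v, y⁆ * (y * u⁻¹ * y⁻¹) := by
            simp only [commutatorElement_def]; group
        _ = ⁅u, y⁆ * ⁅v, y⁆ := by
            rw [mul_assoc, ← mem_center_iff.1 (hy v), commutatorElement_def u]; group
  refine ⟨QuotientGroup.lift (center G) φ fun v hv ↦ ?_, fun v ↦ rfl⟩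
  refine Subtype.ext ?_
  change ⁅v, y⁆ = 1
  rw [commutatorElement_eq_one_iff_mul_comm, mem_center_iff.1 hv]

/-- Here `t + 1` and `q` are the Hirsch lengths of the centre and of the quotient by it, and `k` is
the index of a nontrivial cyclic group generated by a commutator in its isolator in the centre. -/
theorem exists_counting_bounds [Group.IsNilpotent G] (h : HasNoTorsion G)
    (hfg : HasFGSubgroups G) (hna : ∃ x y : G, x * y ≠ y * x) :
    ∃ q t k : ℕ, HasHirschLength G (q + t + 1) ∧ ∀ X : ℕ,
      ((subgroupsLE G X).Finite ∧
        (subgroupsLE G X).ncard ≤ Nat.sqrt (k * X) * X ^ t * X ^ q) ∧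
      ({H ∈ subgroupsLE G X | H.Normal}.ncard : ℝ) ≤ k * X ^ q * X ^ t * harmonic X := by
  have hQ0 : Nontrivial (G ⧸ center G) := by
    by_contra hs
    rw [not_nontrivial_iff_subsingleton] at hs
    obtain ⟨x, y, hxy⟩ := hna
    have : y ∈ center G := (QuotientGroup.eq_one_iff y).1 (Subsingleton.elim _ _)
    exact hxy (mem_center_iff.1 this x)
  obtain ⟨⟨q₀, hq₀⟩, hq₁⟩ := (ne_bot_iff_exists_ne_one).1
    (Group.IsNilpotent.center_ne_bot (G ⧸ center G))
  obtain ⟨y, rfl⟩ := QuotientGroup.mk'_surjective _ q₀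
  have hy : y ∉ center G := fun hy ↦
    hq₁ (Subtype.ext ((QuotientGroup.eq_one_iff y).2 hy))
  obtain ⟨x, hx⟩ : ∃ x, x * y ≠ y * x := by
    by_contra! h0
    exact hy (mem_center_iff.2 h0)
  set π := QuotientGroup.mk' (center G) with hπ
  have hcomm : ∀ v : G, ⁅v, y⁆ ∈ center G := fun v ↦ by
    rw [← QuotientGroup.eq_one_iff]
    change π ⁅v, y⁆ = 1
    rw [map_commutatorElement, commutatorElement_eq_one_iff_mul_comm, mem_center_iff.1 hq₀]
  have hker : π.ker = center G := QuotientGroup.ker_mk' _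
  have hxyk : ⁅x, y⁆ ∈ π.ker := hker.ge (hcomm x)
  obtain ⟨ψ, hψ⟩ := exists_commutator_hom hcomm
  obtain ⟨q, hq⟩ := exists_isPolyInt h.quotient_center
    (hfg.of_surjective (QuotientGroup.mk'_surjective (center G)))
  have hq0 : q ≠ 0 := by
    rintro rfl
    exact not_subsingleton _ hq
  let _ : CommGroup π.ker :=
    { (inferInstance : Group π.ker) with
      mul_comm := fun a b ↦ Subtype.ext (mem_center_iff.1 (hker.le b.2) a) }
  obtain ⟨Z, hwZ, ⟨e⟩, t, ht⟩ := exists_isolator (A := π.ker) (h.subgroup _) (hfg.subgroup _)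
    (w := ⟨⁅x, y⁆, hxyk⟩) fun h0 ↦ hx (by
      rw [← commutatorElement_eq_one_iff_mul_comm]
      exact congrArg Subtype.val h0)
  let ρ := QuotientGroup.mk' Z
  have hρ : Function.Surjective ρ := QuotientGroup.mk'_surjective Z
  have hρk : ρ.ker = Z := QuotientGroup.ker_mk' Z
  let e' : ρ.ker ≃* Multiplicative ℤ := (MulEquiv.subgroupCongr hρk).trans e
  let w : ρ.ker := ⟨⟨⁅x, y⁆, hxyk⟩, by rw [hρk]; exact hwZ⟩
  have hw : w ≠ 1 := fun h0 ↦ hx (by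
    rw [← commutatorElement_eq_one_iff_mul_comm]
    exact congrArg (fun v : ρ.ker ↦ ((v : π.ker) : G)) h0)
  have hsurj : Function.Surjective π := QuotientGroup.mk'_surjective _
  refine ⟨q, t, (e' w).toAdd.natAbs, ?_, fun X ↦ ⟨?_, ?_⟩⟩
  · have h1 := ((isPolyInt_one_of_mulEquiv e').of_extension hρ ht).of_extension hsurj hq
    rw [show q + t + 1 = 1 + t + q by omega]
    exact h1.hasHirschLength
  · exact finite_and_ncard_subgroupsLE_le hq ht hsurj hρ hker.le e' hw (x := x) (y := y) rfl X
  · exact (finite_and_ncard_normal_le hq hq0 ht hsurj hρ e' hw (x := x) (y := y) rfl ψ hψ X).2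

end Torsion

/-! ### Growth degrees -/

section Growth

theorem sum_ncard_index_eq {G : Type*} [Group G] (P : Subgroup G → Prop) {X : ℕ}
    (hfin : {H ∈ subgroupsLE G X | P H}.Finite) :
    ∑ i ∈ Finset.Icc 1 X, {H : Subgroup G | P H ∧ H.index = i}.ncard =
      {H ∈ subgroupsLE G X | P H}.ncard := by
  classical
  have hmaps : ∀ H ∈ hfin.toFinset, H.index ∈ Finset.Icc 1 X := fun H hH ↦ by
    have h1 := (hfin.mem_toFinset.1 hH).1
    exact Finset.mem_Icc.2 ⟨Nat.pos_of_ne_zero h1.1, h1.2⟩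
  rw [Set.ncard_eq_toFinset_card _ hfin, Finset.card_eq_sum_card_fiberwise hmaps]
  refine Finset.sum_congr rfl fun i hi ↦ ?_
  rw [← Set.ncard_coe_finset]
  congr 1
  ext H
  rw [Finset.mem_coe, Finset.mem_filter, Set.Finite.mem_toFinset]
  obtain ⟨hi1, hiX⟩ := Finset.mem_Icc.1 hi
  constructor
  · rintro ⟨hP, rfl⟩
    exact ⟨⟨⟨Nat.ne_of_gt hi1, hiX⟩, hP⟩, rfl⟩
  · rintro ⟨⟨_, hP⟩, h⟩
    exact ⟨hP, h⟩

theorem sum_numSubgroups_eq {G : Type*} [Group G] {X : ℕ} (hfin : (subgroupsLE G X).Finite) :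
    ∑ i ∈ Finset.Icc 1 X, numSubgroups G i = (subgroupsLE G X).ncard := by
  simpa [numSubgroups] using sum_ncard_index_eq (fun _ : Subgroup G ↦ True) (X := X) (by simpa)

theorem growthDegree_le {a : ℕ → ℕ} {α C : ℝ} (hC : 0 < C)
    (h : ∀ n : ℕ, 1 ≤ n → ((∑ i ∈ Finset.Icc 1 n, a i : ℕ) : ℝ) ≤ C * (n : ℝ) ^ α) :
    growthDegree a ≤ (α : EReal) :=
  sInf_le ⟨α, rfl, C, hC, h⟩

/-- It is enough to bound the partial sums from below at even arguments. -/
theorem le_growthDegree {a : ℕ → ℕ} {h : ℕ}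
    (ha : ∀ n : ℕ, 1 ≤ n → n ^ h ≤ ∑ i ∈ Finset.Icc 1 (2 * n), a i) :
    ((h : ℝ) : EReal) ≤ growthDegree a := by
  refine le_sInf ?_
  rintro _ ⟨α, rfl, C, hC, hα⟩
  rw [EReal.coe_le_coe_iff]
  by_contra! hlt
  have hbd : ∀ n : ℕ, 1 ≤ n → (n : ℝ) ^ ((h : ℝ) - α) ≤ C * 2 ^ α := by
    intro n hn
    have hn0 : (0 : ℝ) < n := by exact_mod_cast hn
    have h1 := (Nat.cast_le.2 (ha n hn)).trans (hα (2 * n) (by omega))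
    rw [Real.rpow_sub hn0, div_le_iff₀ (Real.rpow_pos_of_pos hn0 _), Real.rpow_natCast]
    push_cast at h1
    rwa [Real.mul_rpow zero_le_two hn0.le, ← mul_assoc] at h1
  have ht : Filter.Tendsto (fun n : ℕ ↦ (n : ℝ) ^ ((h : ℝ) - α)) Filter.atTop Filter.atTop :=
    (tendsto_rpow_atTop (sub_pos.2 hlt)).comp tendsto_natCast_atTop_atTop
  obtain ⟨n, hn1, hn⟩ :=
    ((ht.eventually_gt_atTop (C * 2 ^ α)).and (Filter.eventually_ge_atTop 1)).exists
  exact (hbd n hn).not_gt hn1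

theorem alphaSub_le_of_sqrt_bound {G : Type*} [Group G] {q t k : ℕ}
    (h : ∀ X, (subgroupsLE G X).Finite ∧
      (subgroupsLE G X).ncard ≤ Nat.sqrt (k * X) * X ^ t * X ^ q) :
    alphaSub G ≤ ((((q + t + 1 : ℕ) : ℝ) - 1 / 2 : ℝ) : EReal) := by
  refine growthDegree_le (C := √k + 1) (by positivity) fun X hX ↦ ?_
  have hX0 : (0 : ℝ) < X := by exact_mod_cast hX
  rw [sum_numSubgroups_eq (h X).1]
  have h1 : ((q + t + 1 : ℕ) : ℝ) - 1 / 2 = 1 / 2 + ((t + q : ℕ) : ℝ) := by push_cast; ring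
  calc ((subgroupsLE G X).ncard : ℝ) ≤ (Nat.sqrt (k * X) * X ^ t * X ^ q : ℕ) :=
        Nat.cast_le.2 (h X).2
    _ = Nat.sqrt (k * X) * (X : ℝ) ^ (t + q) := by push_cast; ring
    _ ≤ √((k * X : ℕ) : ℝ) * (X : ℝ) ^ (t + q) := by
        gcongr; exact Real.nat_sqrt_le_real_sqrt
    _ = √k * (X : ℝ) ^ (((q + t + 1 : ℕ) : ℝ) - 1 / 2) := by
        rw [h1, Real.rpow_add hX0, Real.rpow_natCast, ← Real.sqrt_eq_rpow, Nat.cast_mul,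
          Real.sqrt_mul (Nat.cast_nonneg k), mul_assoc]
    _ ≤ _ := by gcongr; linarith

theorem one_add_log_le {ε : ℝ} (hε : 0 < ε) {X : ℝ} (hX : 1 ≤ X) :
    1 + Real.log X ≤ (1 + 1 / ε) * X ^ ε := by
  have h1 := Real.log_le_rpow_div (zero_le_one.trans hX) hε
  have h2 := Real.one_le_rpow hX hε.le
  calc 1 + Real.log X ≤ X ^ ε + X ^ ε / ε := add_le_add h2 h1
    _ = _ := by ring

/-- The harmonic sum is absorbed by an arbitrarily small power of `X`. -/
theorem alphaNormal_le_of_harmonic_bound {G : Type*} [Group G] {q t k : ℕ}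
    (hfin : ∀ X, (subgroupsLE G X).Finite)
    (h : ∀ X : ℕ, ({H ∈ subgroupsLE G X | H.Normal}.ncard : ℝ) ≤
      k * X ^ q * X ^ t * harmonic X) :
    alphaNormal G ≤ ((((q + t + 1 : ℕ) : ℝ) - 1 : ℝ) : EReal) := by
  by_contra! hlt
  obtain ⟨r, hr1, hr2⟩ := EReal.lt_iff_exists_real_btwn.1 hlt
  rw [EReal.coe_lt_coe_iff] at hr1
  have hε : 0 < r - ((t + q : ℕ) : ℝ) := by push_cast at hr1 ⊢; linarith
  set ε := r - ((t + q : ℕ) : ℝ) with hεdef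
  refine hr2.not_ge (growthDegree_le (C := (k + 1) * (1 + 1 / ε)) (by positivity) fun X hX ↦ ?_)
  have hX1 : (1 : ℝ) ≤ X := by exact_mod_cast hX
  have hX0 : (0 : ℝ) < X := zero_lt_one.trans_le hX1
  have hsum : ∑ i ∈ Finset.Icc 1 X, numNormalSubgroups G i =
      {H ∈ subgroupsLE G X | H.Normal}.ncard :=
    sum_ncard_index_eq _ ((hfin X).subset fun H hH ↦ hH.1)
  rw [hsum]
  calc ({H ∈ subgroupsLE G X | H.Normal}.ncard : ℝ) ≤ k * X ^ q * X ^ t * harmonic X := h X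
    _ = k * (X : ℝ) ^ (t + q) * harmonic X := by ring
    _ ≤ (k + 1) * (X : ℝ) ^ (t + q) * ((1 + 1 / ε) * (X : ℝ) ^ ε) := by
        gcongr
        · exact_mod_cast (harmonic_pos (Nat.ne_of_gt hX)).le
        · linarith
        · exact (harmonic_le_one_add_log X).trans (one_add_log_le hε hX1)
    _ = (k + 1) * (1 + 1 / ε) * (X : ℝ) ^ (((t + q : ℕ) : ℝ) + ε) := by
        rw [Real.rpow_add hX0, Real.rpow_natCast]; ring
    _ = _ := by rw [hεdef, add_sub_cancel]

end Growth

/-! ### Free abelian groups and the classification -/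

section FreeAbelian

/-- The homomorphism `v ↦ v₀ + c₁ v₁ + ⋯ + cₘ vₘ` modulo `n`. -/
def monicFunctional {m n : ℕ} (c : Fin m → ZMod n) :
    Multiplicative (Fin (m + 1) → ℤ) →* Multiplicative (ZMod n) :=
  AddMonoidHom.toMultiplicative
    (AddMonoidHom.mk' (fun v : Fin (m + 1) → ℤ ↦ (v 0 : ZMod n) + ∑ i, c i * (v i.succ : ZMod n))
      fun v w ↦ by
        simp only [Pi.add_apply, Int.cast_add, mul_add, Finset.sum_add_distrib]
        abel)

theorem mem_ker_monicFunctional {m n : ℕ} {c : Fin m → ZMod n} {v : Fin (m + 1) → ℤ} :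
    Multiplicative.ofAdd v ∈ (monicFunctional c).ker ↔
      (v 0 : ZMod n) + ∑ i, c i * (v i.succ : ZMod n) = 0 :=
  Iff.rfl

theorem monicFunctional_ker_injective {m n : ℕ} :
    Function.Injective fun c : Fin m → ZMod n ↦ (monicFunctional c).ker := by
  intro c c' h
  funext j
  obtain ⟨z, hz⟩ := ZMod.intCast_surjective (c j)
  have h1 : ∀ d : Fin m → ZMod n,
      Multiplicative.ofAdd (Fin.cons (-z) (Pi.single j 1) : Fin (m + 1) → ℤ) ∈
        (monicFunctional d).ker ↔ -c j + d j = 0 := fun d ↦ by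
    rw [mem_ker_monicFunctional, Fin.cons_zero, Int.cast_neg, hz,
      Finset.sum_eq_single j (fun i _ hij ↦ by simp [Pi.single_eq_of_ne hij]) (by simp)]
    simp
  have h2 := (h1 c').1 (by
    rw [← show (monicFunctional c).ker = (monicFunctional c').ker from h]
    exact (h1 c).2 (neg_add_cancel _))
  exact (neg_add_eq_zero.1 h2)

theorem index_ker_monicFunctional {m n : ℕ} (c : Fin m → ZMod n) :
    (monicFunctional c).ker.index = n := by
  have hsurj : Function.Surjective (monicFunctional c) := fun z ↦ by
    obtain ⟨y, hy⟩ := ZMod.intCast_surjective z.toAdd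
    refine ⟨Multiplicative.ofAdd (Fin.cons y 0), ?_⟩
    change (y : ZMod n) + ∑ i, c i * (((Fin.cons y 0 : Fin (m + 1) → ℤ) i.succ : ℤ) : ZMod n) =
      z.toAdd
    simp [hy]
  rw [index_ker, (monicFunctional c).range_eq_top.2 hsurj, card_top]
  exact Nat.card_zmod n

theorem pow_le_numSubgroups {m n : ℕ} (hn : n ≠ 0) :
    n ^ m ≤ numSubgroups (Multiplicative (Fin (m + 1) → ℤ)) n := by
  have : NeZero n := ⟨hn⟩
  have hfin := ((isPolyInt_multiplicative_pi (m + 1)).finite_and_ncard_le n).1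
  have hfin' : {H : Subgroup (Multiplicative (Fin (m + 1) → ℤ)) | H.index = n}.Finite :=
    hfin.subset fun H hH ↦ ⟨fun h0 ↦ hn (hH.symm.trans h0), hH.le⟩
  calc n ^ m = (Set.range fun c : Fin m → ZMod n ↦ (monicFunctional c).ker).ncard := by
        rw [← Set.image_univ, Set.ncard_image_of_injective _ monicFunctional_ker_injective,
          Set.ncard_univ, Nat.card_fun]
        simp
    _ ≤ _ := Set.ncard_le_ncard (Set.range_subset_iff.2 index_ker_monicFunctional) hfin'

theorem alphaSub_multiplicative_pi (h : ℕ) :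
    alphaSub (Multiplicative (Fin h → ℤ)) = ((h : ℝ) : EReal) := by
  have hcount := (isPolyInt_multiplicative_pi h).finite_and_ncard_le
  refine le_antisymm (growthDegree_le one_pos fun X _ ↦ ?_) (le_growthDegree fun n hn ↦ ?_)
  · rw [sum_numSubgroups_eq (hcount X).1, one_mul, Real.rpow_natCast]
    exact_mod_cast (hcount X).2
  · cases h with
    | zero =>
      rw [sum_numSubgroups_eq (hcount _).1, pow_zero, Nat.one_le_iff_ne_zero, ← Nat.pos_iff_ne_zero,
        Set.ncard_pos (hcount _).1]
      exact ⟨⊤, by simp, by rw [index_top]; omega⟩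
    | succ m =>
      calc n ^ (m + 1) = ∑ i ∈ Finset.Icc (n + 1) (2 * n), n ^ m := by
            rw [Finset.sum_const, Nat.card_Icc, smul_eq_mul, pow_succ']
            congr 1; omega
        _ ≤ ∑ i ∈ Finset.Icc (n + 1) (2 * n),
              numSubgroups (Multiplicative (Fin (m + 1) → ℤ)) i := by
            refine Finset.sum_le_sum fun i hi ↦ ?_
            obtain ⟨h1, -⟩ := Finset.mem_Icc.1 hi
            exact (Nat.pow_le_pow_left (by omega) m).trans (pow_le_numSubgroups (by omega))
        _ ≤ _ := Finset.sum_le_sum_of_subset (Finset.Icc_subset_Icc_left (by omega))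

theorem isTGroup_multiplicative_pi (h : ℕ) : IsTGroup (Multiplicative (Fin h → ℤ)) where
  fg := by
    obtain ⟨s, hs⟩ := (isPolyInt_multiplicative_pi h).isGeneratedBy ⊤
    exact Group.fg_def.2 ⟨(Set.finite_range s).toFinset, by simpa using hs⟩
  nilpotent := inferInstance
  torsionFree := fun g hg hfin ↦ by
    obtain ⟨n, hn, hgn⟩ := isOfFinOrder_iff_pow_eq_one.1 hfin
    refine hg ?_
    have h1 : n • g.toAdd = 0 := hgn
    exact (smul_eq_zero.1 h1).resolve_left hn.ne'

end FreeAbelian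

theorem IsTGroup.hasNoTorsion {N : Type*} [Group N] (hN : IsTGroup N) : HasNoTorsion N := by
  intro g n hn hgn
  by_contra hg
  exact hN.torsionFree g hg (isOfFinOrder_iff_pow_eq_one.2 ⟨n, Nat.pos_of_ne_zero hn, hgn⟩)

theorem IsTGroup.growth_le {N : Type*} [Group N] {h : ℕ} (hN : IsTGroup N)
    (hh : HasHirschLength N h) (hna : ∃ x y : N, x * y ≠ y * x) :
    alphaSub N ≤ (((h : ℝ) - 1 / 2 : ℝ) : EReal) ∧
      alphaNormal N ≤ (((h : ℝ) - 1 : ℝ) : EReal) := by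
  have := hN.nilpotent
  obtain ⟨q, t, k, hqt, hb⟩ :=
    exists_counting_bounds hN.hasNoTorsion hh.exists_isGeneratedBy hna
  obtain rfl := hh.unique hqt
  exact ⟨alphaSub_le_of_sqrt_bound fun X ↦ (hb X).1,
    alphaNormal_le_of_harmonic_bound (fun X ↦ (hb X).1.1) fun X ↦ (hb X).2⟩

theorem theoremA :
    -- the bounds for non-abelian groups
    (∀ (N : Type u) [Group N] (h : ℕ),
      IsTGroup N → HasHirschLength N h → (∃ x y : N, x * y ≠ y * x) →
        (Group.nilpotencyClass N = 2 →
          alphaSub N ≤ (((h : ℝ) - 1 / 2 : ℝ) : EReal)) ∧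
        (2 < Group.nilpotencyClass N →
          alphaSub N ≤ (((h : ℝ) - 1 / ((Group.nilpotencyClass N : ℝ) - 1) : ℝ) : EReal)) ∧
        alphaNormal N ≤ (((h : ℝ) - 1 : ℝ) : EReal)) ∧
    -- `ℤ ^ h` is a `𝔗`-group of Hirsch length `h` whose subgroup growth degree is `h` …
    (∀ h : ℕ, IsTGroup (Multiplicative (Fin h → ℤ)) ∧
      HasHirschLength (Multiplicative (Fin h → ℤ)) h ∧
      alphaSub (Multiplicative (Fin h → ℤ)) = ((h : ℝ) : EReal)) ∧
    -- … and, up to isomorphism, it is the only one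
    (∀ (N : Type u) [Group N] (h : ℕ),
      IsTGroup N → HasHirschLength N h → alphaSub N = ((h : ℝ) : EReal) →
        Nonempty (N ≃* Multiplicative (Fin h → ℤ))) := by
  refine ⟨fun N _ h hN hh hna ↦ ?_, fun h ↦ ⟨isTGroup_multiplicative_pi h,
    (isPolyInt_multiplicative_pi h).hasHirschLength, alphaSub_multiplicative_pi h⟩,
    fun N _ h hN hh hα ↦ ?_⟩
  · obtain ⟨h1, h2⟩ := hN.growth_le hh hna
    refine ⟨fun _ ↦ h1, fun hc ↦ h1.trans (EReal.coe_le_coe_iff.2 ?_), h2⟩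
    have hc' : (3 : ℝ) ≤ Group.nilpotencyClass N := by exact_mod_cast hc
    gcongr
    linarith
  · have hcomm : ∀ x y : N, x * y = y * x := by
      by_contra! hna
      have h1 := (hN.growth_le hh hna).1
      rw [hα, EReal.coe_le_coe_iff] at h1
      linarith
    let _ : CommGroup N := { ‹Group N› with mul_comm := hcomm }
    obtain ⟨n, ⟨e⟩⟩ := exists_mulEquiv_of_commGroup hN.hasNoTorsion hh.exists_isGeneratedBy
    obtain rfl := hh.unique ((isPolyInt_multiplicative_pi n).of_mulEquiv e.symm).hasHirschLength
    exact ⟨e⟩
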